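/- Let $k\ge 2$ be an integer and $m=\frac1{k-1}$. Consider the linear differential equation $$(E_k)\qquad \Big[\prod_{j=0}^{k-1}\big(2k\lambda\partial_\lambda+2j+1\big)+\partial_\lambda\Big]f=0 ,$$ written in the variable $x=\lambda^{m}$ (so $\lambda=x^{k-1}$ and $\partial_\lambda=m\,x^{2-k}\frac{d}{dx}$). A formal solution is a finite sum of formal expressions $e^{q(x)}(\log x)^j x^\beta\,\Psi(x^{1/r})$ that satisfies the equation, where $q(x)=\sum_\nu q_\nu x^{-\nu}$ is a finite sum over positive rational $\nu$ with $q_\nu\in\mathbb C$, $j\in\mathbb N$, $\beta\in\mathbb C$, $r\ge1$ is an integer and $\Psi\in\mathbb C[[t]]$. A series $\sum_n a_n t^n\in\mathbb C[[t]]$ is Gevrey of order $s>0$ if there are $C,A>0$ with $|a_n|\le C A^n (n!)^s$ for all $n\ge0$. The polynomial $$P(u)=-mu\big[(-1)^{k-1}(2k)^k(mu)^{k-1}+1\big]$$ has exactly $k$ distinct complex roots $u_0=0,u_1,\dots,u_{k-1}$, and there are formal power series $\widetilde\Phi_0,\dots,\widetilde\Phi_{k-1}\in\mathbb C[[x]]$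 such that: 1. the expressions $e^{u_i/x}\widetilde\Phi_i(x)$, $0\le i\le k-1$, are linearly independent over $\mathbb C$, and the formal solutions of $(E_k)$ in the variable $x$ are exactly the $$\Phi(x)=\sigma_0\widetilde\Phi_0(x)+\sigma_1e^{u_1/x}\widetilde\Phi_1(x)+\dots+\sigma_{k-1}e^{u_{k-1}/x}\widetilde\Phi_{k-1}(x),\qquad \sigma_0,\dots,\sigma_{k-1}\in\mathbb C;$$ 2. every $\widetilde\Phi_i(x)$ is Gevrey of order $1$; 3. the partition function $Z_0(\lambda)=\int_{\mathbb R}e^{-\frac12\phi^2-\lambda\phi^{2k}}\frac{d\phi}{\sqrt{2\pi}}$ has an asymptotic expansion $\widetilde Z_0(\lambda)=\sum_{n\ge0}a_n\lambda^n$ as $\lambda\to0$ in $\{\Re\lambda>0\}$, meaning that $\lambda^{-N}\big[Z_0(\lambda)-\sum_{n=0}^N a_n\lambda^n\big]\to0$ for every $N\ge0$; there is a constant $c\ne0$ with $\widetilde Z_0(\lambda)=c\,\widetilde\Phi_0(\lambda^m)$, that is $\widetilde Z_0(x^{k-1})=c\,\widetilde\Phi_0(x)$ in $\mathbb C[[x]]$;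 and $\widetilde Z_0(\lambda)$ is Gevrey of order $\frac1m=k-1$. -/

import Mathlib

open PowerSeries

noncomputable section

namespace PartitionResurgence

/-- A determining factor `q(x) = ∑_ν q_ν x^{-ν}` (finite sum, `ν` positive rational). -/
abbrev DetFactor : Type := {ν : ℚ // 0 < ν} →₀ ℂ

/-- Arrays of coefficients of formal expressions
`∑ f (q, j, β) • e^{q(x)} (log x)^j x^β`, with `q` a determining factor, `j` a natural number
and `β` a complex exponent. No condition is imposed on the support here, see
`formalFunctions`. -/
abbrev FormalArray : Type := DetFactor × ℕ × ℂ → ℂ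

/-- The formal derivation `d/dx`. It comes from
`d/dx (e^{q} (log x)^j x^γ)
  = γ e^{q} (log x)^j x^{γ-1} + j e^{q} (log x)^{j-1} x^{γ-1}
    + ∑_ν (-ν q_ν) e^{q} (log x)^j x^{γ-ν-1}`. -/
def ddx : FormalArray →ₗ[ℂ] FormalArray where
  toFun f := fun p =>
    (p.2.2 + 1) * f (p.1, p.2.1, p.2.2 + 1)
      + ((p.2.1 : ℂ) + 1) * f (p.1, p.2.1 + 1, p.2.2 + 1)
      + p.1.sum fun ν c => -((ν : ℚ) : ℂ) * c * f (p.1, p.2.1, p.2.2 + 1 + ((ν : ℚ) : ℂ))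
  map_add' f g := by
    funext p
    simp only [Pi.add_apply, mul_add, Finsupp.sum, Finset.sum_add_distrib]
    ring
  map_smul' a f := by
    funext p
    simp only [Pi.smul_apply, smul_eq_mul, RingHom.id_apply, Finsupp.sum, mul_add,
      Finset.mul_sum]
    refine congrArg₂ _ (by ring) (Finset.sum_congr rfl fun _ _ => by ring)

/-- Multiplication by `x^n`, `n` an integer. -/
def mulXPow (n : ℤ) : FormalArray →ₗ[ℂ] FormalArray where
  toFun f := fun p => f (p.1, p.2.1, p.2.2 - (n : ℂ))
  map_add' _ _ := rfl
  map_smul' _ _ := rfl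

/-- The formal expression `e^{q(x)} (log x)^j x^β Ψ(x^{1/r})`, for `r ≥ 1`: its coefficient at
`e^{q} (log x)^j x^{β + n/r}` is the `n`-th coefficient of `Ψ`, all others vanish. -/
def elementary (q : DetFactor) (j : ℕ) (β : ℂ) (r : ℕ) (Ψ : ℂ⟦X⟧) : FormalArray :=
  Function.extend (fun n : ℕ => ((q, j, β + (n : ℂ) / (r : ℂ)) : DetFactor × ℕ × ℂ))
    (fun n => coeff n Ψ) 0

/-- The space in which formal solutions of linear differential equations at `x = 0` live:
finite sums of expressions `e^{q(x)} (log x)^j x^β Ψ(x^{1/r})` with `q` a polynomial without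
constant term in a negative rational power of `x`, `j ∈ ℕ`, `β ∈ ℂ`, `r ≥ 1` and `Ψ` a formal
power series. -/
def formalFunctions : Submodule ℂ FormalArray :=
  Submodule.span ℂ
    {f | ∃ (q : DetFactor) (j : ℕ) (β : ℂ) (r : ℕ) (Ψ : ℂ⟦X⟧),
      0 < r ∧ f = elementary q j β r Ψ}

/-- The formal expression `e^{u/x} Ψ(x)`. -/
def expMul (u : ℂ) (Ψ : ℂ⟦X⟧) : FormalArray :=
  elementary (Finsupp.single ⟨1, one_pos⟩ u) 0 0 1 Ψ

/-- The operator `∏_{j=0}^{k-1} (2k λ∂ + 2j + 1) + ∂`, where `L` is the multiplication by `λ`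
and `D` is the derivation `∂ = d/dλ`. -/
def opE {M : Type*} [AddCommGroup M] [Module ℂ M] (k : ℕ) (L D : Module.End ℂ M) :
    Module.End ℂ M :=
  ((List.range k).map fun j : ℕ =>
      (2 * k : ℂ) • (L * D) + (2 * j + 1 : ℂ) • (1 : Module.End ℂ M)).prod + D

/-- The operator of `(E_k)` written in the variable `x = λ^{1/(k-1)}`, that is `λ = x^{k-1}` and,
by the chain rule, `d/dλ = (k-1)⁻¹ x^{2-k} d/dx`. -/
def opEx (k : ℕ) : Module.End ℂ FormalArray :=
  opE k (mulXPow ((k : ℤ) - 1)) (((1 : ℂ) / ((k : ℂ) - 1)) • (mulXPow (2 - (k : ℤ)) ∘ₗ ddx))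

/-- `P(u) = - m u [(-1)^{k-1} (2k)^k (m u)^{k-1} + 1]`, with `m = 1/(k-1)`. -/
def charPoly (k : ℕ) (u : ℂ) : ℂ :=
  let m : ℂ := 1 / ((k : ℂ) - 1);
  (-m) * u * ((-1) ^ (k - 1) * (2 * (k : ℂ)) ^ k * (m * u) ^ (k - 1) + 1)

/-- Formal power series that are Gevrey of order `s`. -/
def IsGevrey (s : ℝ) (Ψ : ℂ⟦X⟧) : Prop :=
  ∃ C > (0 : ℝ), ∃ A > (0 : ℝ), ∀ n : ℕ,
    ‖coeff n Ψ‖ ≤ C * A ^ n * ((n.factorial : ℝ) ^ s)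

/-- The partition function
`Z_0(λ) = ∫_ℝ e^{-φ²/2 - λ φ^{2k}} dφ / √(2π)`. -/
def partitionFunction (k : ℕ) (l : ℂ) : ℂ :=
  ∫ φ : ℝ, Complex.exp (-(1 / 2) * (φ : ℂ) ^ 2 - l * (φ : ℂ) ^ (2 * k))
    / ((Real.sqrt (2 * Real.pi) : ℝ) : ℂ)

/-- `Ψ` is the asymptotic expansion of `f` at `0` in the half-plane `Re λ > 0`. -/
def IsAsymptoticExpansion (f : ℂ → ℂ) (Ψ : ℂ⟦X⟧) : Prop :=
  ∀ N : ℕ, Filter.Tendsto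
    (fun l : ℂ => (l ^ N)⁻¹ * (f l - ∑ n ∈ Finset.range (N + 1), coeff n Ψ * l ^ n))
    (nhdsWithin 0 {l : ℂ | 0 < l.re}) (nhds 0)

end PartitionResurgence

end

noncomputable section

namespace PartitionResurgence

section

/-! ### The Euler operator and the equation -/

/-! Put K = k - 1, θ = x d/dx and A = 2(K+1)/K. The equation becomes ∏_{j≤K} (Aθ + 2j + 1) + K⁻¹
x^{-K} θ, where θ acts on the e^q-component as x d/dx + ∑ (-ν q_ν) x^{-ν}.

Uniqueness is a Newton polygon argument. A formal solution has a term of lowest order along each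
rational line of exponents, and the leading part of the operator must kill it. If q contains some ν
> 1, the leading part is a nonzero scalar; if all ν ≤ 1, it is multiplication by P(q_1), so q_1 is a
root of P. The roots are simple, so writing θ = w x⁻¹ + δ with w = -q_1 the next term is a nonzero
multiple of x^{-K} δ. This excludes any further exponent ν < 1. For q = u/x it says that δ kills the
leading term, which leaves neither logarithms nor any exponent but 0 (`eq_zero_of_opEx_eq_zero`).

Conversely, at each root the coefficients satisfy a recurrence solvable from a_0 = 1
(`opEx_expMul_solCoeff`), whose growth gives Gevrey order 1 (`isGevrey_solCoeff`).

Gaussian moments turn the perturbative series of Z_0 into a power series solution in x^K. Uniqueness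
makes it a multiple of Φ_0, and its Gevrey order K follows from that of Φ_0. -/

/-- The Euler operator `x d/dx`. -/
def euler : Module.End ℂ FormalArray := mulXPow 1 ∘ₗ ddx

/-- Multiplication by `x⁻¹`. -/
def invX : Module.End ℂ FormalArray := mulXPow (-1)

theorem euler_apply (f : FormalArray) (q : DetFactor) (j : ℕ) (β : ℂ) :
    euler f (q, j, β) = β * f (q, j, β) + ((j : ℂ) + 1) * f (q, j + 1, β)
      + q.sum fun ν c => -((ν : ℚ) : ℂ) * c * f (q, j, β + ((ν : ℚ) : ℂ)) := by
  simp [euler, mulXPow, ddx]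

theorem invX_apply (f : FormalArray) (q : DetFactor) (j : ℕ) (β : ℂ) :
    invX f (q, j, β) = f (q, j, β + 1) := by
  simp [invX, mulXPow]

theorem invX_pow_apply (n : ℕ) (f : FormalArray) (q : DetFactor) (j : ℕ) (β : ℂ) :
    (invX ^ n) f (q, j, β) = f (q, j, β + n) := by
  induction n generalizing β with
  | zero => simp
  | succ n ih =>
    rw [pow_succ', Module.End.mul_apply, invX_apply, ih]
    push_cast
    ring_nf

theorem euler_mul_invX : euler * invX = invX * (euler - 1) := by
  ext f ⟨q, j, β⟩
  have h : ∀ ν : ℂ, β + ν + 1 = β + 1 + ν := fun ν => by ring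
  simp only [Module.End.mul_apply, LinearMap.sub_apply, Module.End.one_apply, euler_apply,
    invX_apply, Pi.sub_apply, h]
  ring

/-- The product `∏_{j<n} (A θ + 2j + 1)` with `θ` the Euler operator. -/
def eulerProd (A : ℂ) (n : ℕ) : Module.End ℂ FormalArray :=
  ((List.range n).map fun j : ℕ =>
    A • euler + (2 * j + 1 : ℂ) • (1 : Module.End ℂ FormalArray)).prod

@[simp] theorem eulerProd_zero (A : ℂ) : eulerProd A 0 = 1 := by simp [eulerProd]

theorem eulerProd_succ (A : ℂ) (n : ℕ) :
    eulerProd A (n + 1) = eulerProd A n *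
      (A • euler + (2 * n + 1 : ℂ) • (1 : Module.End ℂ FormalArray)) := by
  simp [eulerProd, List.range_succ]

/-- Chain rule for λ = x^K: λ∂_λ = K⁻¹ θ and ∂_λ = K⁻¹ x^{-K} θ. -/
theorem opEx_eq (K : ℕ) :
    opEx (K + 1) = eulerProd (2 * (K + 1) * (1 / K)) (K + 1)
      + (1 / K : ℂ) • (invX ^ K * euler) := by
  have h1 : mulXPow (((K + 1 : ℕ) : ℤ) - 1) *
      (((1 : ℂ) / (((K + 1 : ℕ) : ℂ) - 1)) • (mulXPow (2 - ((K + 1 : ℕ) : ℤ)) ∘ₗ ddx))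
      = (1 / K : ℂ) • euler := by
    ext f ⟨q, j, β⟩
    simp only [Module.End.mul_apply, mulXPow, euler, LinearMap.smul_apply, LinearMap.comp_apply,
      LinearMap.coe_mk, AddHom.coe_mk, Pi.smul_apply]
    push_cast
    congr 3
    · ring
    · ring_nf
  have h2 : (((1 : ℂ) / (((K + 1 : ℕ) : ℂ) - 1)) • (mulXPow (2 - ((K + 1 : ℕ) : ℤ)) ∘ₗ ddx))
      = (1 / K : ℂ) • (invX ^ K * euler) := by
    ext f ⟨q, j, β⟩
    simp only [Module.End.mul_apply, LinearMap.smul_apply, Pi.smul_apply, invX_pow_apply]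
    simp only [mulXPow, euler, LinearMap.comp_apply, LinearMap.coe_mk, AddHom.coe_mk]
    push_cast
    congr 3
    · ring
    · ring_nf
  rw [opEx, opE, h1, h2, eulerProd]
  congr 5
  ext1 j
  rw [smul_smul]
  push_cast
  rfl

/-! ### Orders of formal expressions and of operators -/

/-- The coefficients of `f` at `e^q (log x)^j x^γ` with `γ ∈ β - ℚ_{>0}` vanish. -/
def VanishesBelow (q : DetFactor) (β : ℂ) (f : FormalArray) : Prop :=
  ∀ t : ℚ, 0 < t → ∀ j, f (q, j, β - (t : ℂ)) = 0

/-- The operator `T` lowers orders by at most `s` in the `e^q`-component. -/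
def Lowers (q : DetFactor) (s : ℚ) (T : Module.End ℂ FormalArray) : Prop :=
  ∀ f β, VanishesBelow q β f → VanishesBelow q (β - (s : ℂ)) (T f)

/-- The operator `T` lowers orders by at most `s` in the `e^q`-component, and acts on the leading
coefficients as the multiplication by `τ`. -/
def HasLeading (q : DetFactor) (s : ℚ) (τ : ℂ) (T : Module.End ℂ FormalArray) : Prop :=
  Lowers q s T ∧ ∀ f β, VanishesBelow q β f → ∀ j, T f (q, j, β - (s : ℂ)) = τ * f (q, j, β)

variable {q : DetFactor} {s s' : ℚ} {τ τ' : ℂ} {T T' : Module.End ℂ FormalArray}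

theorem VanishesBelow.apply_sub_eq_zero {f : FormalArray} {β γ : ℂ} (h : VanishesBelow q β f)
    (t : ℚ) (ht : 0 < t) (hγ : γ = β - t) (j : ℕ) : f (q, j, γ) = 0 :=
  hγ ▸ h t ht j

theorem Lowers.mono (h : Lowers q s T) (hs : s ≤ s') : Lowers q s' T := fun f β hf t ht j =>
  (h f β hf).apply_sub_eq_zero (s' - s + t) (by linarith) (by push_cast; ring) j

theorem Lowers.hasLeading_zero (h : Lowers q s T) (hs : s < s') : HasLeading q s' 0 T :=
  ⟨h.mono hs.le, fun f β hf j => by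
    rw [zero_mul]
    exact (h f β hf).apply_sub_eq_zero (s' - s) (by linarith) (by push_cast; ring) j⟩

theorem Lowers.zero : Lowers q s 0 := fun _ _ _ _ _ _ => rfl

theorem Lowers.one : Lowers q 0 1 := fun f β hf => by simpa using hf

theorem Lowers.add (h : Lowers q s T) (h' : Lowers q s T') : Lowers q s (T + T') :=
  fun f β hf t ht j => by
    simp [h f β hf t ht j, h' f β hf t ht j]

theorem Lowers.smul (c : ℂ) (h : Lowers q s T) : Lowers q s (c • T) :=
  fun f β hf t ht j => by simp [h f β hf t ht j]

theorem Lowers.mul (h : Lowers q s T) (h' : Lowers q s' T') : Lowers q (s + s') (T * T') :=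
  fun f β hf t ht j =>
    (h _ _ (h' f β hf)).apply_sub_eq_zero t ht (by push_cast; ring) j

theorem HasLeading.one : HasLeading q 0 1 1 :=
  ⟨.one, fun f β _ j => by simp⟩

theorem HasLeading.add (h : HasLeading q s τ T) (h' : HasLeading q s τ' T') :
    HasLeading q s (τ + τ') (T + T') :=
  ⟨h.1.add h'.1, fun f β hf j => by
    simp [h.2 f β hf j, h'.2 f β hf j, add_mul]⟩

theorem HasLeading.smul (c : ℂ) (h : HasLeading q s τ T) : HasLeading q s (c * τ) (c • T) :=
  ⟨h.1.smul c, fun f β hf j => by simp [h.2 f β hf j, mul_assoc]⟩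

theorem HasLeading.mul (h : HasLeading q s τ T) (h' : HasLeading q s' τ' T') :
    HasLeading q (s + s') (τ * τ') (T * T') :=
  ⟨h.1.mul h'.1, fun f β hf j => by
    have := h.2 _ _ (h'.1 f β hf) j
    rw [h'.2 f β hf j] at this
    rw [Module.End.mul_apply, mul_assoc, ← this]
    push_cast
    ring_nf⟩

theorem HasLeading.eq_zero (h : HasLeading q s τ T) (hτ : τ ≠ 0) {f : FormalArray} {β : ℂ}
    (hf : VanishesBelow q β f) (hT : T f = 0) (j : ℕ) : f (q, j, β) = 0 := by
  have := h.2 f β hf j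
  rw [hT] at this
  simpa [hτ] using this

theorem invX_pow_hasLeading (n : ℕ) : HasLeading q n 1 (invX ^ n) := by
  refine ⟨fun f β hf t ht j => ?_, fun f β hf j => ?_⟩ <;> rw [invX_pow_apply]
  · exact hf.apply_sub_eq_zero t ht (by push_cast; ring) j
  · simp

/-! ### The Euler operator without its term of order one -/

/-- The difference `x d/dx - w x⁻¹`. -/
def eulerSub (w : ℂ) : Module.End ℂ FormalArray := euler - w • invX

theorem euler_eq (w : ℂ) : euler = w • invX + eulerSub w := by simp [eulerSub]

theorem eulerSub_mul_invX (w : ℂ) : eulerSub w * invX = invX * (eulerSub w - 1) := by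
  simp only [eulerSub, sub_mul, mul_sub, euler_mul_invX, smul_mul_assoc, mul_smul_comm]
  abel

theorem eulerSub_apply (f : FormalArray) (q : DetFactor) (j : ℕ) (β : ℂ) :
    eulerSub (-(q ⟨1, one_pos⟩)) f (q, j, β)
      = β * f (q, j, β) + ((j : ℂ) + 1) * f (q, j + 1, β)
      + (q.erase ⟨1, one_pos⟩).sum fun ν c =>
          -((ν : ℚ) : ℂ) * c * f (q, j, β + ((ν : ℚ) : ℂ)) := by
  have h := Finsupp.add_sum_erase' q ⟨1, one_pos⟩
    (fun ν c => -((ν : ℚ) : ℂ) * c * f (q, j, β + ((ν : ℚ) : ℂ))) (by simp)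
  simp only [eulerSub, LinearMap.sub_apply, LinearMap.smul_apply, Pi.sub_apply, Pi.smul_apply,
    euler_apply, invX_apply, ← h, smul_eq_mul]
  push_cast
  ring

/-- The leading term of an operator that acts on the `e^q`-component as
`x d/dx + ∑_ν (-ν p_ν) x^{-ν}`. -/
theorem hasLeading_of_apply {p : DetFactor}
    (hT : ∀ f j β, T f (q, j, β) = β * f (q, j, β) + ((j : ℂ) + 1) * f (q, j + 1, β)
      + p.sum fun ν c => -((ν : ℚ) : ℂ) * c * f (q, j, β + ((ν : ℚ) : ℂ)))
    (μ : {ν : ℚ // 0 < ν}) (hμ : ∀ ν ∈ p.support, ν ≤ μ) :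
    HasLeading q μ (-((μ : ℚ) : ℂ) * p μ) T := by
  have hμ0 := μ.2
  refine ⟨fun f β hf t ht j => ?_, fun f β hf j => ?_⟩
  · rw [hT, hf.apply_sub_eq_zero (μ + t) (by linarith) (by push_cast; ring),
      hf.apply_sub_eq_zero (μ + t) (by linarith) (by push_cast; ring)]
    rw [Finsupp.sum, Finset.sum_eq_zero]
    · simp
    intro ν hν
    have : (ν : ℚ) ≤ μ := hμ ν hν
    rw [hf.apply_sub_eq_zero (μ + t - ν) (by linarith) (by push_cast; ring), mul_zero]
  · rw [hT, hf.apply_sub_eq_zero μ (by linarith) rfl, hf.apply_sub_eq_zero μ (by linarith) rfl,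
      Finsupp.sum, Finset.sum_eq_single μ]
    · simp
    · intro ν hν hne
      have : (ν : ℚ) < μ := lt_of_le_of_ne (hμ ν hν) (fun h => hne (Subtype.ext h))
      rw [hf.apply_sub_eq_zero (μ - ν) (by linarith) (by push_cast; ring), mul_zero]
    · intro h
      simp [Finsupp.notMem_support_iff.1 h]

/-- The expansion of `∏_{j≤n} (A θ + 2j + 1)` around its two leading terms, for `θ = w x⁻¹ + δ`
with `δ` of order `s`. -/
theorem exists_eulerProd_eq (A w : ℂ) (hs : 0 ≤ s) (hs1 : s ≤ 1)
    (hδ : Lowers q s (eulerSub w)) (n : ℕ) :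
    ∃ R, Lowers q ((n : ℚ) - 1 + 2 * s) R ∧
      eulerProd A (n + 1) = (A * w) ^ (n + 1) • invX ^ (n + 1)
        + (A * w) ^ n • (invX ^ n * (((n + 1) * A) • eulerSub w
            + ((n + 1) ^ 2 - A * n * (n + 1) / 2 : ℂ) • (1 : Module.End ℂ FormalArray)))
        + R := by
  induction n with
  | zero =>
    refine ⟨0, .zero, ?_⟩
    rw [eulerProd_succ, eulerProd_zero, euler_eq w]
    simp only [one_mul, zero_add, pow_one, pow_zero, smul_add, smul_smul]
    simp [add_assoc]
  | succ n ih =>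
    obtain ⟨R, hR, h⟩ := ih
    have h1 : Lowers q s (A • eulerSub w
        + (2 * (n + 1 : ℕ) + 1 : ℂ) • (1 : Module.End ℂ FormalArray)) :=
      (hδ.smul _).add ((Lowers.one.mono hs).smul _)
    have h2 : Lowers q s (((n + 1) * A) • eulerSub w
            + ((n + 1) ^ 2 - A * n * (n + 1) / 2 : ℂ) • (1 : Module.End ℂ FormalArray)) :=
      (hδ.smul _).add ((Lowers.one.mono hs).smul _)
    have hX : Lowers q 1 ((A * w) • invX) := by
      have := (invX_pow_hasLeading (q := q) 1).1
      rw [pow_one] at this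
      simpa using this.smul (A * w)
    -- The new factor is (A w) x⁻¹ plus a part of order s. The remainder collects the product of two
    -- parts of order s, and the old remainder times the whole factor; s ≤ 1 bounds the latter.
    refine ⟨(A * w) ^ n • (invX ^ n * (((n + 1) * A) • eulerSub w
            + ((n + 1) ^ 2 - A * n * (n + 1) / 2 : ℂ) • (1 : Module.End ℂ FormalArray)) *
          (A • eulerSub w + (2 * (n + 1 : ℕ) + 1 : ℂ) • (1 : Module.End ℂ FormalArray)))
        + (R * ((A * w) • invX) + R * (A • eulerSub w
            + (2 * (n + 1 : ℕ) + 1 : ℂ) • (1 : Module.End ℂ FormalArray))), ?_, ?_⟩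
    · refine Lowers.add ?_ (Lowers.add ?_ ?_)
      · refine (((invX_pow_hasLeading n).1.mul h2).mul h1).smul _ |>.mono ?_
        push_cast; linarith
      · refine (hR.mul hX).mono ?_
        push_cast; linarith
      · refine (hR.mul h1).mono ?_
        push_cast; linarith
    · have hB : A • euler + (2 * (n + 1 : ℕ) + 1 : ℂ) • (1 : Module.End ℂ FormalArray)
          = (A * w) • invX + (A • eulerSub w
            + (2 * (n + 1 : ℕ) + 1 : ℂ) • (1 : Module.End ℂ FormalArray)) := by
        rw [euler_eq w, smul_add, smul_smul, add_assoc]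
      rw [eulerProd_succ, h, hB]
      generalize hδ' : eulerSub w = δ
      -- Moving each δ to the right of the powers of x⁻¹ produces -A n(n+1)/2 in all, while (n+1)²
      -- is the sum of the odd numbers 2j + 1.
      have hc : δ * invX = invX * δ - invX := by
        rw [← hδ', eulerSub_mul_invX, mul_sub, mul_one]
      simp only [add_mul, mul_add, smul_mul_assoc, mul_smul_comm, mul_assoc, hc, mul_one, one_mul,
        smul_add, smul_smul, mul_sub, smul_sub, pow_succ]
      push_cast
      module

/-- The coefficient of `x^{-(k-1)} δ` in the operator of `(E_k)`, `k = K + 1`. -/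
def subleading (K : ℕ) (w : ℂ) : ℂ :=
  (2 * (K + 1) * (1 / K) * w) ^ K * ((K + 1) * (2 * (K + 1) * (1 / K))) + 1 / K

/-- The sign comes from θ e^{u/x} = -u x⁻¹ e^{u/x}, so that w = -u. -/
theorem charPoly_neg {K : ℕ} (w : ℂ) :
    charPoly (K + 1) (-w) = (2 * (K + 1) * (1 / K) * w) ^ (K + 1) + 1 / K * w := by
  simp only [charPoly, Nat.add_sub_cancel]
  push_cast
  rw [add_sub_cancel_right, ← neg_one_mul w]
  have : ((-1 : ℂ) ^ K) * (-1) ^ K = 1 := by rw [← mul_pow]; simp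
  simp only [mul_pow]
  linear_combination (1 / K * w * 2 ^ (K + 1) * (K + 1) ^ (K + 1) * (1 / K) ^ K * w ^ K) * this

theorem exists_opEx_eq {K : ℕ} (hK : 1 ≤ K) (w : ℂ) (hs : 0 ≤ s) (hs1 : s ≤ 1)
    (hδ : Lowers q s (eulerSub w)) :
    ∃ R, Lowers q ((K : ℚ) - 1 + 2 * s) R ∧
      opEx (K + 1) = charPoly (K + 1) (-w) • invX ^ (K + 1)
        + subleading K w • (invX ^ K * eulerSub w) + R := by
  obtain ⟨R, hR, h⟩ := exists_eulerProd_eq (2 * (K + 1) * (1 / K)) w hs hs1 hδ K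
  refine ⟨R, hR, ?_⟩
  have hK0 : (K : ℂ) ≠ 0 := by exact_mod_cast (by omega : K ≠ 0)
  -- For this value of A the scalar next to δ cancels. This is why the solutions carry no power x^β
  -- in front.
  have h0 : ((K + 1) ^ 2 - 2 * (K + 1) * (1 / K) * K * (K + 1) / 2 : ℂ) = 0 := by
    field_simp
    ring
  rw [opEx_eq, h, h0, charPoly_neg, subleading, euler_eq w]
  simp only [zero_smul, add_zero, mul_add, smul_add, mul_smul_comm, smul_smul, ← pow_succ]
  module

end

section

/-! ### Uniqueness of formal solutions -/

/-- Every half-line `β - ℚ_{≥0}` of exponents meets the support in a finite set. -/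
def HasLowerFiniteSupport (f : FormalArray) : Prop :=
  ∀ q β, {p : ℕ × ℚ | 0 ≤ p.2 ∧ f (q, p.1, β - (p.2 : ℂ)) ≠ 0}.Finite

theorem HasLowerFiniteSupport.add {f g : FormalArray} (hf : HasLowerFiniteSupport f)
    (hg : HasLowerFiniteSupport g) : HasLowerFiniteSupport (f + g) := fun q β => by
  refine ((hf q β).union (hg q β)).subset ?_
  rintro p ⟨hp, h⟩
  by_cases h0 : f (q, p.1, β - (p.2 : ℂ)) = 0
  · exact Or.inr ⟨hp, by simpa [h0] using h⟩
  · exact Or.inl ⟨hp, h0⟩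

theorem HasLowerFiniteSupport.smul (c : ℂ) {f : FormalArray} (hf : HasLowerFiniteSupport f) :
    HasLowerFiniteSupport (c • f) := fun q β => by
  refine (hf q β).subset ?_
  rintro p ⟨hp, h⟩
  exact ⟨hp, fun h0 => h (by simp [h0])⟩

/-- Comparing real parts in β + n/r = γ - t with t ≥ 0 bounds n. -/
theorem hasLowerFiniteSupport_elementary (q : DetFactor) (j : ℕ) (β : ℂ) (r : ℕ) (hr : 0 < r)
    (Ψ : ℂ⟦X⟧) : HasLowerFiniteSupport (elementary q j β r Ψ) := fun q' γ => by
  have hr' : (0 : ℝ) < r := by exact_mod_cast hr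
  obtain ⟨N, hN⟩ := exists_nat_ge ((r : ℝ) * (γ.re - β.re))
  have hfin : ((fun n : ℕ => ((j, β + (n : ℂ) / (r : ℂ)) : ℕ × ℂ)) '' Set.Iic N).Finite :=
    (Set.finite_Iic N).image _
  have hinj : Function.Injective (fun p : ℕ × ℚ => ((p.1, γ - (p.2 : ℂ)) : ℕ × ℂ)) := by
    rintro ⟨a, b⟩ ⟨c, d⟩ h
    simpa using h
  refine (hfin.preimage hinj.injOn).subset ?_
  rintro ⟨j', t⟩ ⟨ht, h⟩
  have hex : ∃ n : ℕ, ((q, j, β + (n : ℂ) / (r : ℂ)) : DetFactor × ℕ × ℂ)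
      = (q', j', γ - (t : ℂ)) := by
    by_contra hne
    exact h (Function.extend_apply' _ _ _ hne)
  obtain ⟨n, hn⟩ := hex
  simp only [Prod.mk.injEq] at hn
  refine ⟨n, ?_, by simp [hn.2.1, hn.2.2]⟩
  have hre := congrArg Complex.re hn.2.2
  have h1 : ((n : ℂ) / (r : ℂ)).re = (n : ℝ) / r := by
    rw [← Complex.ofReal_natCast, ← Complex.ofReal_natCast, ← Complex.ofReal_div,
      Complex.ofReal_re]
  have h2 : ((t : ℂ)).re = (t : ℝ) := Complex.ratCast_re t
  rw [Complex.add_re, Complex.sub_re, h1, h2] at hre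
  have ht' : (0 : ℝ) ≤ t := by exact_mod_cast ht
  have h3 : (n : ℝ) / r ≤ γ.re - β.re := by linarith
  rw [div_le_iff₀ hr'] at h3
  have h4 : (n : ℝ) ≤ N := by linarith [mul_comm (r : ℝ) (γ.re - β.re)]
  exact_mod_cast h4

theorem hasLowerFiniteSupport_of_mem {f : FormalArray} (hf : f ∈ formalFunctions) :
    HasLowerFiniteSupport f := by
  induction hf using Submodule.span_induction with
  | mem f h =>
    obtain ⟨q, j, β, r, Ψ, hr, rfl⟩ := h
    exact hasLowerFiniteSupport_elementary q j β r hr Ψ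
  | zero => intro q β; simp
  | add f g _ _ hf hg => exact hf.add hg
  | smul c f _ hf => exact hf.smul c

theorem HasLowerFiniteSupport.exists_leading {f : FormalArray} (hf : HasLowerFiniteSupport f)
    {q : DetFactor} {j : ℕ} {β : ℂ} (h : f (q, j, β) ≠ 0) :
    ∃ γ i, VanishesBelow q γ f ∧ f (q, i, γ) ≠ 0 ∧ ∀ l, i < l → f (q, l, γ) = 0 := by
  -- Lexicographic maximum: the lowest exponent first, then the highest power of log x at that
  -- exponent.
  obtain ⟨⟨i, t⟩, ⟨ht, hi⟩, hmax⟩ := Set.exists_max_image _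
    (fun p : ℕ × ℚ => toLex (p.2, p.1)) (hf q β) ⟨(j, 0), le_rfl, by simpa using h⟩
  refine ⟨β - t, i, fun t' ht' l => ?_, hi, fun l hl => ?_⟩
  · by_contra hne
    have := hmax (l, t + t') ⟨by positivity, by
      intro h0; apply hne; rw [← h0]; push_cast; ring_nf⟩
    rw [Prod.Lex.toLex_le_toLex] at this
    rcases this with h | h <;> [have := h; have := h.1] <;> simp only at this <;> linarith
  · by_contra hne
    have := hmax (l, t) ⟨ht, hne⟩
    rw [Prod.Lex.toLex_le_toLex] at this
    rcases this with h | h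
    · exact lt_irrefl _ h
    · exact absurd h.2 (not_le.2 hl)

theorem eq_zero_of_hasLeading {q : DetFactor} {s : ℚ} {τ : ℂ} {T : Module.End ℂ FormalArray}
    (h : HasLeading q s τ T) (hτ : τ ≠ 0) {f : FormalArray} (hf : HasLowerFiniteSupport f)
    (hT : T f = 0) (j : ℕ) (β : ℂ) : f (q, j, β) = 0 := by
  by_contra hne
  obtain ⟨γ, i, hγ, hi, -⟩ := hf.exists_leading hne
  exact hi (h.eq_zero hτ hγ hT i)

theorem eulerProd_hasLeading {q : DetFactor} {s : ℚ} {τ : ℂ} (h : HasLeading q s τ euler)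
    (hs : 0 < s) (A : ℂ) (n : ℕ) : HasLeading q (n * s) ((A * τ) ^ n) (eulerProd A n) := by
  induction n with
  | zero => simpa using HasLeading.one
  | succ n ih =>
    have h1 := (h.smul A).add ((Lowers.one.smul (2 * n + 1 : ℂ)).hasLeading_zero hs)
    have := ih.mul h1
    rw [← eulerProd_succ, add_zero, ← pow_succ] at this
    convert this using 1
    push_cast
    ring

/-- `subleading K w` is the derivative of w ↦ P(-w), so this is the simplicity of the roots. Its
value is 1/K at w = 0 and -1 at the other roots. -/
theorem subleading_ne_zero {K : ℕ} (hK : 1 ≤ K) {w : ℂ} (hw : charPoly (K + 1) (-w) = 0) :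
    subleading K w ≠ 0 := by
  have hK0 : (K : ℂ) ≠ 0 := by exact_mod_cast (by omega : K ≠ 0)
  rcases eq_or_ne w 0 with rfl | hw0
  · simp [subleading, hK0, show K ≠ 0 by omega]
  · rw [charPoly_neg] at hw
    have h1 : (2 * (K + 1) * (1 / K) * w : ℂ) ^ K * (2 * (K + 1) * (1 / K)) = - (1 / K) := by
      apply mul_right_cancel₀ hw0
      rw [pow_succ] at hw
      linear_combination hw
    have : subleading K w = -1 := by
      rw [subleading]
      have h2 : (1 / K * K : ℂ) = 1 := by field_simp
      linear_combination (K + 1) * h1 - h2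
    rw [this]
    simp

variable {K : ℕ} {f : FormalArray}

/-- With μ > 1 the largest exponent of q, the product has order (K+1)μ and dominates x^{-K} θ, of
order K + μ. -/
theorem apply_eq_zero_of_one_lt (hf : HasLowerFiniteSupport f) (hK : 1 ≤ K)
    (hT : opEx (K + 1) f = 0) {q : DetFactor} {ν : {ν : ℚ // 0 < ν}} (hν : ν ∈ q.support)
    (h1 : (1 : ℚ) < ν) (j : ℕ) (β : ℂ) : f (q, j, β) = 0 := by
  have hK0 : (K : ℂ) ≠ 0 := by exact_mod_cast (by omega : K ≠ 0)
  obtain ⟨μ, hμ, hmax⟩ := q.support.exists_max_image id ⟨ν, hν⟩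
  have hμ1 : (1 : ℚ) < μ := lt_of_lt_of_le h1 (hmax ν hν)
  have he : HasLeading q μ (-((μ : ℚ) : ℂ) * q μ) euler :=
    hasLeading_of_apply (fun f j β => euler_apply f q j β) μ hmax
  have hKq : (1 : ℚ) ≤ K := by exact_mod_cast hK
  have h2 := (((invX_pow_hasLeading (q := q) K).1.mul he.1).smul (1 / K : ℂ)).hasLeading_zero
    (s' := ((K + 1 : ℕ) : ℚ) * μ) (by push_cast; nlinarith)
  have h3 := (eulerProd_hasLeading he μ.2 (2 * (K + 1) * (1 / K)) (K + 1)).add h2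
  rw [← opEx_eq] at h3
  refine eq_zero_of_hasLeading h3 ?_ hf hT j β
  have : ((μ : ℚ) : ℂ) ≠ 0 := by exact_mod_cast μ.2.ne'
  have h4 : ((K : ℂ) + 1) ≠ 0 := by exact_mod_cast K.succ_ne_zero
  rw [add_zero]
  exact pow_ne_zero _ (mul_ne_zero (mul_ne_zero (mul_ne_zero two_ne_zero h4)
    (one_div_ne_zero hK0)) (mul_ne_zero (neg_ne_zero.2 this) (Finsupp.mem_support_iff.1 hμ)))

/-- Here both terms of the operator have order K + 1, and their leading scalars add up to P(q_1). -/
theorem apply_eq_zero_of_charPoly_ne_zero (hf : HasLowerFiniteSupport f)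
    (hT : opEx (K + 1) f = 0) {q : DetFactor} (hq : ∀ ν ∈ q.support, (ν : ℚ) ≤ 1)
    (hP : charPoly (K + 1) (q ⟨1, one_pos⟩) ≠ 0) (j : ℕ) (β : ℂ) : f (q, j, β) = 0 := by
  have he : HasLeading q 1 (-(1 : ℚ) * q ⟨1, one_pos⟩) euler :=
    hasLeading_of_apply (fun f j β => euler_apply f q j β) ⟨1, one_pos⟩ hq
  have h3 := (eulerProd_hasLeading he one_pos (2 * (K + 1) * (1 / K)) (K + 1)).add
    (s := ((K + 1 : ℕ) : ℚ) * 1) (τ' := 1 / K * (1 * (-(1 : ℚ) * q ⟨1, one_pos⟩)))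
    (T' := (1 / K : ℂ) • (invX ^ K * euler)) (by
      have := ((invX_pow_hasLeading (q := q) K).mul he).smul (1 / K : ℂ)
      convert this using 1
      push_cast; ring)
  rw [← opEx_eq] at h3
  refine eq_zero_of_hasLeading h3 ?_ hf hT j β
  convert hP using 1
  rw [← neg_neg (q ⟨1, one_pos⟩), charPoly_neg]
  push_cast
  ring

/-- With μ < 1 the largest exponent left, x^{-K} δ has order K + μ, above the order K - 1 + 2μ of
the remainder. -/
theorem apply_eq_zero_of_erase_ne_zero (hf : HasLowerFiniteSupport f) (hK : 1 ≤ K)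
    (hT : opEx (K + 1) f = 0) {q : DetFactor} (hq : ∀ ν ∈ q.support, (ν : ℚ) ≤ 1)
    (hP : charPoly (K + 1) (q ⟨1, one_pos⟩) = 0) (hne : q.erase ⟨1, one_pos⟩ ≠ 0)
    (j : ℕ) (β : ℂ) : f (q, j, β) = 0 := by
  obtain ⟨μ, hμ, hmax⟩ := (q.erase ⟨1, one_pos⟩).support.exists_max_image id
    (Finsupp.support_nonempty_iff.2 hne)
  have hd : HasLeading q μ (-((μ : ℚ) : ℂ) * (q.erase ⟨1, one_pos⟩) μ)
      (eulerSub (-(q ⟨1, one_pos⟩))) :=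
    hasLeading_of_apply (fun f j β => eulerSub_apply f q j β) μ hmax
  have hμ1 : (μ : ℚ) < 1 := by
    rw [Finsupp.support_erase, Finset.mem_erase] at hμ
    exact lt_of_le_of_ne (hq μ hμ.2) fun h => hμ.1 (Subtype.ext h)
  obtain ⟨R, hR, hop⟩ := exists_opEx_eq hK _ μ.2.le hμ1.le hd.1
  rw [neg_neg, hP, zero_smul, zero_add] at hop
  have h3 := (((invX_pow_hasLeading (q := q) K).mul hd).smul
    (subleading K (-(q ⟨1, one_pos⟩)))).add
      (hR.hasLeading_zero (s' := (K : ℚ) + μ) (by linarith))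
  rw [← hop] at h3
  refine eq_zero_of_hasLeading h3 ?_ hf hT j β
  have : ((μ : ℚ) : ℂ) ≠ 0 := by exact_mod_cast μ.2.ne'
  rw [add_zero, one_mul]
  exact mul_ne_zero (subleading_ne_zero hK (by rwa [neg_neg]))
    (mul_ne_zero (neg_ne_zero.2 this) (Finsupp.mem_support_iff.1 hμ))

theorem apply_single_eq_zero (hf : HasLowerFiniteSupport f) (hK : 1 ≤ K)
    (hT : opEx (K + 1) f = 0) {u : ℂ} (hP : charPoly (K + 1) u = 0)
    (h0 : f (Finsupp.single ⟨1, one_pos⟩ u, 0, 0) = 0) (j : ℕ) (β : ℂ) :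
    f (Finsupp.single ⟨1, one_pos⟩ u, j, β) = 0 := by
  set q : DetFactor := Finsupp.single ⟨1, one_pos⟩ u with hqdef
  have hq1 : q ⟨1, one_pos⟩ = u := Finsupp.single_eq_same
  have hqe : q.erase ⟨1, one_pos⟩ = 0 := by rw [hqdef, Finsupp.erase_single]
  have happ : ∀ (f : FormalArray) j β, eulerSub (-u) f (q, j, β)
      = β * f (q, j, β) + ((j : ℂ) + 1) * f (q, j + 1, β) := fun f j β => by
    have := eulerSub_apply f q j β
    rwa [hq1, hqe, Finsupp.sum_zero_index, add_zero] at this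
  have hd : Lowers q 0 (eulerSub (-u)) := fun f γ hf t ht j => by
    rw [happ, hf.apply_sub_eq_zero t ht (by push_cast; ring),
      hf.apply_sub_eq_zero t ht (by push_cast; ring)]
    simp
  obtain ⟨R, hR, hop⟩ := exists_opEx_eq hK _ le_rfl zero_le_one hd
  rw [neg_neg, hP, zero_smul, zero_add] at hop
  have hκ := subleading_ne_zero hK (w := -u) (by rwa [neg_neg])
  by_contra hne
  obtain ⟨γ, i, hγ, hi, hi'⟩ := hf.exists_leading hne
  -- The coefficient at x^{γ-K}: the remainder lowers orders by at most K - 1, so only x^{-K} δ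
  -- contributes. At the top power of log x this forces γ = 0, and one power below it forces the top
  -- power to be 0.
  have key : ∀ l, γ * f (q, l, γ) + ((l : ℂ) + 1) * f (q, l + 1, γ) = 0 := fun l => by
    have h1 := congrFun hT (q, l, γ - (K : ℂ))
    rw [hop] at h1
    have h2 := hR f γ hγ 1 one_pos l
    simp only [LinearMap.add_apply, LinearMap.smul_apply, Pi.add_apply, Pi.smul_apply,
      Module.End.mul_apply, invX_pow_apply, happ, sub_add_cancel] at h1
    have h3 : R f (q, l, γ - (K : ℂ)) = 0 := by
      rw [← h2]
      push_cast
      ring_nf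
    rw [h3, add_zero] at h1
    exact (mul_eq_zero.1 h1).resolve_left hκ
  have hγ0 : γ = 0 := by
    have := key i
    rw [hi' (i + 1) (Nat.lt_succ_self i), mul_zero, add_zero] at this
    exact (mul_eq_zero.1 this).resolve_right hi
  subst hγ0
  rcases i with _ | i
  · exact hi h0
  · have := key i
    rw [zero_mul, zero_add] at this
    exact hi ((mul_eq_zero.1 this).resolve_left (by exact_mod_cast i.succ_ne_zero))

/-- A formal solution is determined by its coefficients at `e^{u/x}`, `u` a root of the
characteristic polynomial. -/
theorem eq_zero_of_opEx_eq_zero (hf : HasLowerFiniteSupport f) (hK : 1 ≤ K)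
    (hT : opEx (K + 1) f = 0)
    (h0 : ∀ u, charPoly (K + 1) u = 0 → f (Finsupp.single ⟨1, one_pos⟩ u, 0, 0) = 0) : f = 0 := by
  ext ⟨q, j, β⟩
  by_cases h1 : ∃ ν ∈ q.support, (1 : ℚ) < ν
  · obtain ⟨ν, hν, h1⟩ := h1
    exact apply_eq_zero_of_one_lt hf hK hT hν h1 j β
  push Not at h1
  by_cases hP : charPoly (K + 1) (q ⟨1, one_pos⟩) = 0
  · by_cases he : q.erase ⟨1, one_pos⟩ = 0
    · have hq : q = Finsupp.single ⟨1, one_pos⟩ (q ⟨1, one_pos⟩) := by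
        conv_lhs => rw [← Finsupp.single_add_erase ⟨1, one_pos⟩ q, he, add_zero]
      rw [hq]
      exact apply_single_eq_zero hf hK hT hP (h0 _ hP) j β
    · exact apply_eq_zero_of_erase_ne_zero hf hK hT h1 hP he j β
  · exact apply_eq_zero_of_charPoly_ne_zero hf hT h1 hP j β

end

/-! ### Existence of formal solutions, and their Gevrey order -/

/-- The expression `e^{u/x} ∑_β a(β) x^β`. -/
def expSeries (u : ℂ) (a : ℂ → ℂ) : FormalArray := fun p =>
  if p.1 = Finsupp.single ⟨1, one_pos⟩ u ∧ p.2.1 = 0 then a p.2.2 else 0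

theorem expMul_eq (u : ℂ) (Ψ : ℂ⟦X⟧) :
    expMul u Ψ = expSeries u (Function.extend (Nat.cast : ℕ → ℂ) (fun n => coeff n Ψ) 0) := by
  have hinj : Function.Injective (fun n : ℕ =>
      ((Finsupp.single ⟨1, one_pos⟩ u, 0, 0 + (n : ℂ) / ((1 : ℕ) : ℂ)) : DetFactor × ℕ × ℂ)) := by
    intro a b h
    simpa using h
  ext ⟨q, j, β⟩
  rw [expMul, elementary, expSeries]
  by_cases h : ∃ n : ℕ,
    ((Finsupp.single ⟨1, one_pos⟩ u, 0, 0 + (n : ℂ) / ((1 : ℕ) : ℂ)) : DetFactor × ℕ × ℂ)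
      = (q, j, β)
  · obtain ⟨n, hn⟩ := h
    rw [← hn, hinj.extend_apply]
    simp [Nat.cast_injective.extend_apply]
  · rw [Function.extend_apply' _ _ _ h]
    split_ifs with h1
    · rw [Function.extend_apply']
      · rfl
      · rintro ⟨n, hn⟩
        refine h ⟨n, ?_⟩
        obtain ⟨h2, h3⟩ := h1
        simp only at h2 h3 hn
        simp [h2, h3, hn]
    · rfl

theorem expMul_apply (u : ℂ) (Ψ : ℂ⟦X⟧) (n : ℕ) :
    expMul u Ψ (Finsupp.single ⟨1, one_pos⟩ u, 0, n) = coeff n Ψ := by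
  simp [expMul_eq, expSeries, Nat.cast_injective.extend_apply]

theorem expMul_apply_of_ne {u v : ℂ} (h : u ≠ v) (Ψ : ℂ⟦X⟧) (j : ℕ) (β : ℂ) :
    expMul u Ψ (Finsupp.single ⟨1, one_pos⟩ v, j, β) = 0 := by
  rw [expMul_eq, expSeries, if_neg]
  rintro ⟨h1, -⟩
  exact h (Finsupp.single_injective _ h1).symm

theorem expMul_mem (u : ℂ) (Ψ : ℂ⟦X⟧) : expMul u Ψ ∈ formalFunctions :=
  Submodule.subset_span ⟨_, _, _, _, _, one_pos, rfl⟩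

theorem euler_expSeries (u : ℂ) (a : ℂ → ℂ) :
    euler (expSeries u a) = expSeries u fun β => β * a β + -u * a (β + 1) := by
  ext ⟨q, j, β⟩
  rw [euler_apply]
  by_cases hq : q = Finsupp.single ⟨1, one_pos⟩ u
  · rw [hq, Finsupp.sum_single_index (by simp)]
    by_cases hj : j = 0 <;> simp [expSeries, hj]
  · simp [expSeries, hq]

theorem invX_pow_expSeries (n : ℕ) (u : ℂ) (a : ℂ → ℂ) :
    (invX ^ n) (expSeries u a) = expSeries u fun β => a (β + n) := by
  ext ⟨q, j, β⟩
  simp [invX_pow_apply, expSeries]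

theorem expSeries_add (u : ℂ) (a b : ℂ → ℂ) :
    expSeries u a + expSeries u b = expSeries u fun β => a β + b β := by
  ext ⟨q, j, β⟩
  simp only [expSeries, Pi.add_apply]
  split_ifs <;> simp

theorem smul_expSeries (c u : ℂ) (a : ℂ → ℂ) :
    c • expSeries u a = expSeries u fun β => c * a β := by
  ext ⟨q, j, β⟩
  simp [expSeries]

theorem expSeries_zero (u : ℂ) : expSeries u (fun _ => 0) = 0 := by
  ext ⟨q, j, β⟩
  simp [expSeries]

/-! ### Recurrence for the coefficients of a solution -/

/-- The coefficients of the operator `∏_{j<n} (A (β + w x⁻¹) + 2j + 1)` acting on the coefficients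
of a series. -/
def prodCoeff (A w : ℂ) : ℕ → ℕ → ℂ → ℂ
  | 0, 0, _ => 1
  | 0, _ + 1, _ => 0
  | n + 1, 0, β => prodCoeff A w n 0 β * (A * β + (2 * n + 1))
  | n + 1, i + 1, β => prodCoeff A w n (i + 1) β * (A * (β + (i + 1 : ℕ)) + (2 * n + 1))
      + prodCoeff A w n i β * (A * w)

theorem prodCoeff_of_lt (A w : ℂ) {n i : ℕ} (h : n < i) (β : ℂ) : prodCoeff A w n i β = 0 := by
  induction n generalizing i with
  | zero =>
    obtain ⟨i, rfl⟩ := Nat.exists_eq_succ_of_ne_zero h.ne'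
    rfl
  | succ n ih =>
    obtain ⟨i, rfl⟩ := Nat.exists_eq_succ_of_ne_zero (by omega : i ≠ 0)
    rw [Nat.succ_eq_add_one, prodCoeff, ih (by omega), ih (by omega)]
    simp

theorem prodCoeff_self (A w : ℂ) (n : ℕ) (β : ℂ) : prodCoeff A w n n β = (A * w) ^ n := by
  induction n with
  | zero => simp [prodCoeff]
  | succ n ih => rw [prodCoeff, ih, prodCoeff_of_lt A w (Nat.lt_succ_self n)]; ring

theorem prodCoeff_succ_self (A w : ℂ) (n : ℕ) (β : ℂ) : prodCoeff A w (n + 1) n β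
    = (A * w) ^ n * ((n + 1) * A * (β + n) + ((n + 1) ^ 2 - A * n * (n + 1) / 2)) := by
  induction n with
  | zero => simp [prodCoeff]
  | succ n ih =>
    rw [prodCoeff, ih, prodCoeff_self]
    push_cast
    ring

theorem eulerProd_expSeries (A u : ℂ) (n : ℕ) (a : ℂ → ℂ) :
    eulerProd A n (expSeries u a) = expSeries u fun β =>
      ∑ i ∈ Finset.range (n + 1), prodCoeff A (-u) n i β * a (β + i) := by
  induction n generalizing a with
  | zero => simp [prodCoeff]
  | succ n ih =>
    rw [eulerProd_succ, Module.End.mul_apply, LinearMap.add_apply, LinearMap.smul_apply,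
      LinearMap.smul_apply, Module.End.one_apply, euler_expSeries, smul_expSeries, smul_expSeries,
      expSeries_add, ih]
    congr 1
    ext β
    -- Reindexing: the extra term i = n + 1 vanishes, so the diagonal part may be summed over the
    -- larger range.
    have h := (Finset.sum_range_succ'
      (fun i : ℕ => prodCoeff A (-u) n i β * (A * (β + i) + (2 * n + 1)) * a (β + i)) (n + 1)).symm
    rw [Finset.sum_range_succ _ (n + 1), prodCoeff_of_lt A _ (Nat.lt_succ_self n), zero_mul,
      zero_mul, add_zero, Nat.cast_zero, add_zero] at h
    rw [Finset.sum_range_succ' _ (n + 1)]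
    simp only [prodCoeff, add_mul _ _ (a _), Finset.sum_add_distrib, Nat.cast_zero, add_zero]
    rw [add_right_comm, h, ← Finset.sum_add_distrib]
    refine Finset.sum_congr rfl fun i _ => ?_
    push_cast
    ring_nf

/-- `prodCoeff A w n i` has degree at most n - i in β. The weight M^i puts all i on one scale, so
that one constant serves in the induction. -/
theorem exists_norm_prodCoeff_le (A w : ℂ) (n : ℕ) : ∃ C : ℝ, 0 ≤ C ∧ ∀ (M : ℝ) (β : ℂ), 1 ≤ M →
    ‖β‖ ≤ M → ∀ i, ‖prodCoeff A w n i β‖ * M ^ i ≤ C * M ^ n := by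
  induction n with
  | zero =>
    refine ⟨1, zero_le_one, fun M β hM hβ i => ?_⟩
    rcases i with _ | i <;> simp [prodCoeff]
  | succ n ih =>
    obtain ⟨C, hC, h⟩ := ih
    have hlin : ∀ (M : ℝ) (β : ℂ), 1 ≤ M → ‖β‖ ≤ M → ∀ i : ℕ, i ≤ n →
        ‖A * (β + i) + (2 * n + 1)‖ ≤ (‖A‖ * (1 + n) + (2 * n + 1)) * M := by
      intro M β hM hβ i hi
      have hi' : (i : ℝ) ≤ n := by exact_mod_cast hi
      have hn : (0 : ℝ) ≤ n := n.cast_nonneg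
      have h1 : ‖β + i‖ ≤ (1 + n) * M := by
        refine (norm_add_le _ _).trans ?_
        rw [Complex.norm_natCast]
        nlinarith
      have h2 : ‖(2 * n + 1 : ℂ)‖ = 2 * n + 1 := by
        have : (2 * n + 1 : ℂ) = ((2 * n + 1 : ℕ) : ℂ) := by push_cast; ring
        rw [this, Complex.norm_natCast]
        push_cast
        ring
      refine (norm_add_le _ _).trans ?_
      rw [norm_mul, h2]
      have h3 := mul_le_mul_of_nonneg_left h1 (norm_nonneg A)
      nlinarith
    refine ⟨C * (‖A‖ * (1 + n) + (2 * n + 1) + ‖A * w‖), by positivity, fun M β hM hβ i => ?_⟩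
    have hM0 : 0 ≤ M := by linarith
    have hD : 0 ≤ C * M ^ n * (‖A * w‖ * M) := by positivity
    rcases i with _ | i
    · rw [prodCoeff, norm_mul]
      have h1 := hlin M β hM hβ 0 (Nat.zero_le _)
      rw [Nat.cast_zero, add_zero] at h1
      have h2 := mul_le_mul (h M β hM hβ 0) h1 (norm_nonneg _) (by positivity)
      calc _ = ‖prodCoeff A w n 0 β‖ * M ^ 0 * ‖A * β + (2 * n + 1)‖ := by ring
        _ ≤ _ := h2
        _ ≤ C * M ^ n * ((‖A‖ * (1 + n) + (2 * n + 1)) * M) + C * M ^ n * (‖A * w‖ * M) := by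
          linarith
        _ = _ := by ring
    · have h1 : ‖prodCoeff A w n (i + 1) β * (A * (β + (i + 1 : ℕ)) + (2 * n + 1))‖ * M ^ (i + 1)
          ≤ C * M ^ n * ((‖A‖ * (1 + n) + (2 * n + 1)) * M) := by
        rcases le_or_gt (i + 1) n with hi | hi
        · rw [norm_mul, mul_right_comm]
          exact mul_le_mul (h M β hM hβ (i + 1)) (hlin M β hM hβ _ hi) (norm_nonneg _)
            (by positivity)
        · rw [prodCoeff_of_lt A w hi, zero_mul, norm_zero, zero_mul]
          positivity
      have h2 : ‖prodCoeff A w n i β * (A * w)‖ * M ^ (i + 1) ≤ C * M ^ n * (‖A * w‖ * M) := by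
        rw [norm_mul, pow_succ]
        calc _ = ‖prodCoeff A w n i β‖ * M ^ i * (‖A * w‖ * M) := by ring
          _ ≤ _ := mul_le_mul_of_nonneg_right (h M β hM hβ i) (by positivity)
      rw [prodCoeff]
      calc _ ≤ (‖prodCoeff A w n (i + 1) β * (A * (β + (i + 1 : ℕ)) + (2 * n + 1))‖
            + ‖prodCoeff A w n i β * (A * w)‖) * M ^ (i + 1) :=
          mul_le_mul_of_nonneg_right (norm_add_le _ _) (by positivity)
        _ ≤ C * M ^ n * ((‖A‖ * (1 + n) + (2 * n + 1)) * M) + C * M ^ n * (‖A * w‖ * M) := by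
          linarith
        _ = _ := by ring

/-- The coefficients of the formal solution at a root of the characteristic polynomial. -/
def solCoeff (K : ℕ) (w : ℂ) (N : ℕ) : ℂ :=
  if N = 0 then 1 else
    -(subleading K w * N)⁻¹ * ∑ i : Fin K,
      prodCoeff (2 * (K + 1) * (1 / K)) w (K + 1) i (N - K) *
        if K ≤ N + i then solCoeff K w (N + i - K) else 0
termination_by N
decreasing_by omega

theorem solCoeff_zero (K : ℕ) (w : ℂ) : solCoeff K w 0 = 1 := by
  rw [solCoeff, if_pos rfl]

theorem solCoeff_rec {K : ℕ} {w : ℂ} (hκ : subleading K w ≠ 0) (N : ℕ) :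
    subleading K w * N * solCoeff K w N = - ∑ i ∈ Finset.range K,
      prodCoeff (2 * (K + 1) * (1 / K)) w (K + 1) i (N - K) *
        if K ≤ N + i then solCoeff K w (N + i - K) else 0 := by
  rcases eq_or_ne N 0 with rfl | hN
  · rw [Nat.cast_zero, mul_zero, zero_mul, Finset.sum_eq_zero, neg_zero]
    intro i hi
    rw [if_neg (by have := Finset.mem_range.1 hi; omega), mul_zero]
  · have hN' : (N : ℂ) ≠ 0 := by exact_mod_cast hN
    rw [solCoeff, if_neg hN, Finset.sum_range]
    field_simp

theorem opEx_expMul_solCoeff {K : ℕ} (hK : 1 ≤ K) {u : ℂ} (hu : charPoly (K + 1) u = 0) :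
    opEx (K + 1) (expMul u (PowerSeries.mk (solCoeff K (-u)))) = 0 := by
  have hκ := subleading_ne_zero hK (w := -u) (by rwa [neg_neg])
  have hP := charPoly_neg (K := K) (-u)
  rw [neg_neg, hu] at hP
  have hK0 : (K : ℂ) ≠ 0 := by exact_mod_cast (by omega : K ≠ 0)
  rw [expMul_eq]
  simp only [coeff_mk]
  set a := Function.extend (Nat.cast : ℕ → ℂ) (solCoeff K (-u)) 0 with ha
  have han : ∀ n : ℕ, a n = solCoeff K (-u) n := fun n => Nat.cast_injective.extend_apply _ _ _
  have ha0 : ∀ z : ℂ, (¬ ∃ n : ℕ, (n : ℂ) = z) → a z = 0 := fun z hz =>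
    Function.extend_apply' _ _ _ hz
  -- The recurrence at every complex β: at β = N - K it defines a_N, and if β + K is not a natural
  -- number every term is zero.
  have hmain : ∀ β, ∑ i ∈ Finset.range K,
      prodCoeff (2 * (K + 1) * (1 / K)) (-u) (K + 1) i β * a (β + i)
        + subleading K (-u) * (β + K) * a (β + K) = 0 := by
    intro β
    by_cases hβ : ∃ N : ℕ, (N : ℂ) = β + K
    · obtain ⟨N, hN⟩ := hβ
      obtain rfl : β = N - K := by rw [hN]; ring
      rw [sub_add_cancel, han, solCoeff_rec hκ, ← sub_eq_add_neg, sub_eq_zero]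
      refine Finset.sum_congr rfl fun i _ => ?_
      congr 1
      split_ifs with h
      · rw [← han]
        congr 1
        push_cast [h]
        ring
      · refine ha0 _ ?_
        rintro ⟨n, hn⟩
        apply h
        have : ((n + K : ℕ) : ℂ) = (N + i : ℕ) := by push_cast; rw [hn]; ring
        have := Nat.cast_injective this
        omega
    · rw [ha0 _ hβ, mul_zero, add_zero]
      refine Finset.sum_eq_zero fun i hi => ?_
      rw [ha0, mul_zero]
      rintro ⟨n, hn⟩
      refine hβ ⟨n + (K - i), ?_⟩
      push_cast [(Finset.mem_range.1 hi).le]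
      rw [hn]
      ring
  rw [opEx_eq, LinearMap.add_apply, eulerProd_expSeries, LinearMap.smul_apply,
    Module.End.mul_apply, euler_expSeries, invX_pow_expSeries, smul_expSeries, expSeries_add,
    ← expSeries_zero u]
  congr 1
  ext β
  -- The term i = K + 1 cancels because u is a root; the term i = K joins x^{-K} θ to give
  -- `subleading`.
  rw [Finset.sum_range_succ, Finset.sum_range_succ, prodCoeff_self, prodCoeff_succ_self,
    ← hmain β, subleading]
  have h0 : ((K + 1) ^ 2 - 2 * (K + 1) * (1 / K) * K * (K + 1) / 2 : ℂ) = 0 := by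
    field_simp
    ring
  rw [h0]
  have h1 : β + (K + 1 : ℕ) = β + K + 1 := by push_cast; ring
  rw [h1]
  linear_combination (-(a (β + K + 1))) * hP

/-! ### Gevrey order 1 of the solutions -/

theorem pow_mul_factorial_sub_le {N l : ℕ} (hl : 1 ≤ l) (hlN : l ≤ N) :
    N ^ l * (N - l).factorial ≤ l ^ l * N.factorial := by
  have h1 : N ≤ l * (N + 1 - l) := by
    obtain ⟨d, rfl⟩ := Nat.exists_eq_add_of_le hlN
    rw [show l + d + 1 - l = d + 1 by omega]
    nlinarith
  calc N ^ l * (N - l).factorial ≤ (l * (N + 1 - l)) ^ l * (N - l).factorial := by gcongr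
    _ = l ^ l * ((N - l).factorial * (N + 1 - l) ^ l) := by rw [mul_pow]; ring
    _ ≤ l ^ l * ((N - l).factorial * N.descFactorial l) := by
      gcongr
      exact Nat.pow_sub_le_descFactorial N l
    _ = _ := by rw [Nat.factorial_mul_descFactorial hlN]

/-- In the recurrence a_{N-l} has a coefficient of size N^{l+1}. Dividing by N leaves N^l, which
(N-l)! absorbs into a constant times N!. -/
theorem isGevrey_solCoeff {K : ℕ} {w : ℂ} (hκ : subleading K w ≠ 0) :
    IsGevrey 1 (PowerSeries.mk (solCoeff K w)) := by
  obtain ⟨C, hC, hc⟩ := exists_norm_prodCoeff_le (2 * (K + 1) * (1 / K)) w (K + 1)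
  set κ := ‖subleading K w‖ with hκdef
  have hκ0 : 0 < κ := norm_pos_iff.2 hκ
  set Q : ℝ := C * (K + 1) ^ (K + 1) * K ^ K with hQ
  have hQ0 : 0 ≤ Q := by positivity
  -- Each of the K terms will cost a factor Q; B is large enough for κB to absorb their sum.
  set B : ℝ := max 1 (K * Q / κ) with hB
  have hB1 : 1 ≤ B := le_max_left _ _
  have hBQ : K * Q ≤ κ * B := by
    rw [mul_comm κ, ← div_le_iff₀ hκ0]
    exact le_max_right _ _
  refine ⟨1, one_pos, B, by linarith, fun n => ?_⟩
  rw [coeff_mk, Real.rpow_one, one_mul]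
  induction n using Nat.strong_induction_on with
  | _ N ih =>
    rcases Nat.eq_zero_or_pos N with rfl | hN
    · simp [solCoeff_zero]
    have hN1 : (1 : ℝ) ≤ N := by exact_mod_cast hN
    have hterm : ∀ i ∈ Finset.range K, ‖prodCoeff (2 * (K + 1) * (1 / K)) w (K + 1) i (N - K) *
        if K ≤ N + i then solCoeff K w (N + i - K) else 0‖
        ≤ Q * N * B ^ (N - 1) * N.factorial := by
      intro i hi
      rw [Finset.mem_range] at hi
      split_ifs with h
      swap
      · rw [mul_zero, norm_zero]; positivity
      obtain ⟨l, hl⟩ : ∃ l, K = i + l := Nat.exists_eq_add_of_le hi.le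
      have hl1 : 1 ≤ l := by omega
      have hlN : l ≤ N := by omega
      have hlK : l ≤ K := by omega
      rw [show N + i - K = N - l by omega, norm_mul]
      have hM : (1 : ℝ) ≤ (K + 1) * N := by
        have : (0 : ℝ) ≤ K := K.cast_nonneg
        nlinarith
      have hβ : ‖(N - K : ℂ)‖ ≤ (K + 1) * N := by
        refine (norm_sub_le _ _).trans ?_
        rw [Complex.norm_natCast, Complex.norm_natCast]
        have : (0 : ℝ) ≤ K := K.cast_nonneg
        nlinarith
      have h1 : ‖prodCoeff (2 * (K + 1) * (1 / K)) w (K + 1) i (N - K)‖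
          ≤ C * ((K + 1) * N) ^ (l + 1) := by
        have h2 := hc _ _ hM hβ i
        have h3 : ((K + 1 : ℝ) * N) ^ (K + 1) = ((K + 1) * N) ^ (l + 1) * ((K + 1) * N) ^ i := by
          rw [← pow_add]; congr 1; omega
        rw [h3, ← mul_assoc] at h2
        exact le_of_mul_le_mul_right h2 (by positivity)
      have h4 : C * ((K + 1 : ℝ) * N) ^ (l + 1) ≤ C * (K + 1) ^ (K + 1) * N * N ^ l := by
        rw [mul_pow]
        have h5 : (K + 1 : ℝ) ^ (l + 1) ≤ (K + 1) ^ (K + 1) :=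
          pow_le_pow_right₀ (by simp) (by omega)
        calc C * ((K + 1 : ℝ) ^ (l + 1) * N ^ (l + 1)) ≤ C * ((K + 1) ^ (K + 1) * N ^ (l + 1)) := by
              gcongr
          _ = _ := by ring
      have h6 : (N : ℝ) ^ l * (N - l).factorial ≤ K ^ K * N.factorial := by
        have h7 : (N : ℝ) ^ l * (N - l).factorial ≤ l ^ l * N.factorial := by
          exact_mod_cast pow_mul_factorial_sub_le hl1 hlN
        refine h7.trans ?_
        have : (l : ℝ) ^ l ≤ K ^ K := by
          have : l ^ l ≤ K ^ K := (Nat.pow_le_pow_left hlK l).trans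
            (Nat.pow_le_pow_right (by omega) hlK)
          exact_mod_cast this
        gcongr
      calc _ ≤ (C * (K + 1) ^ (K + 1) * N * N ^ l) * (B ^ (N - l) * (N - l).factorial) :=
            mul_le_mul (h1.trans h4) (ih _ (by omega)) (norm_nonneg _) (by positivity)
        _ = C * (K + 1) ^ (K + 1) * N * B ^ (N - l) * (N ^ l * (N - l).factorial) := by ring
        _ ≤ C * (K + 1) ^ (K + 1) * N * B ^ (N - 1) * (K ^ K * N.factorial) := by
            have : B ^ (N - l) ≤ B ^ (N - 1) := pow_le_pow_right₀ hB1 (by omega)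
            gcongr
        _ = _ := by rw [hQ]; ring
    have hrec := congrArg norm (solCoeff_rec hκ N)
    rw [norm_mul, norm_mul, norm_neg, Complex.norm_natCast, ← hκdef] at hrec
    have hsum := (norm_sum_le _ _).trans (Finset.sum_le_sum hterm)
    rw [← hrec, Finset.sum_const, Finset.card_range, nsmul_eq_mul] at hsum
    have h8 : κ * N * ‖solCoeff K w N‖ ≤ κ * N * (B ^ N * N.factorial) := by
      refine hsum.trans ?_
      calc _ = (K * Q) * (N * B ^ (N - 1) * N.factorial) := by ring
        _ ≤ (κ * B) * (N * B ^ (N - 1) * N.factorial) := by gcongr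
        _ = κ * N * (B ^ (N - 1) * B * N.factorial) := by ring
        _ = _ := by rw [← pow_succ, Nat.sub_add_cancel hN]
    exact le_of_mul_le_mul_left h8 (by positivity)

/-! ### The perturbative series of the partition function -/

/-- The moments of the standard Gaussian measure. -/
def gaussMoment (n : ℕ) : ℝ :=
  ∫ x : ℝ, x ^ n * (Real.exp (-(1 / 2) * x ^ 2) / Real.sqrt (2 * Real.pi))

theorem integrable_pow_mul_gauss (n : ℕ) : MeasureTheory.Integrable fun x : ℝ =>
    x ^ n * (Real.exp (-(1 / 2) * x ^ 2) / Real.sqrt (2 * Real.pi)) := by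
  have h := integrable_rpow_mul_exp_neg_mul_sq (b := 1 / 2) (by norm_num) (s := n)
    (by have : (0 : ℝ) ≤ n := n.cast_nonneg
        linarith)
  simp only [Real.rpow_natCast] at h
  simpa only [mul_div_assoc] using h.div_const (Real.sqrt (2 * Real.pi))

theorem gaussMoment_zero : gaussMoment 0 = 1 := by
  simp only [gaussMoment, pow_zero, one_mul]
  rw [MeasureTheory.integral_div, integral_gaussian, div_eq_one_iff_eq (by positivity)]
  congr 1
  ring

/-- Integration by parts, as -x e^{-x²/2} is the derivative of e^{-x²/2}. -/
theorem gaussMoment_add_two (n : ℕ) : gaussMoment (n + 2) = (n + 1) * gaussMoment n := by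
  have h := MeasureTheory.integral_mul_deriv_eq_deriv_mul_of_integrable
    (u := fun x : ℝ => x ^ (n + 1)) (u' := fun x : ℝ => ((n + 1 : ℕ) : ℝ) * x ^ n)
    (v := fun x : ℝ => Real.exp (-(1 / 2) * x ^ 2) / Real.sqrt (2 * Real.pi))
    (v' := fun x : ℝ => -x * (Real.exp (-(1 / 2) * x ^ 2) / Real.sqrt (2 * Real.pi)))
    (fun x _ => by simpa using hasDerivAt_pow (n + 1) x)
    (fun x _ => by
      have h1 : HasDerivAt (fun x : ℝ => -(1 / 2) * x ^ 2) (-x) x := by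
        convert! (hasDerivAt_pow 2 x).const_mul (-(1 / 2) : ℝ) using 1
        simp
      convert! h1.exp.div_const (Real.sqrt (2 * Real.pi)) using 1
      ring)
    (by
      convert! (integrable_pow_mul_gauss (n + 2)).neg using 1
      ext x
      simp only [Pi.mul_apply, Pi.neg_apply]
      ring)
    (by
      convert! (integrable_pow_mul_gauss n).const_mul ((n + 1 : ℕ) : ℝ) using 1
      ext x
      simp only [Pi.mul_apply]
      ring)
    (integrable_pow_mul_gauss (n + 1))
  have h1 : gaussMoment (n + 2) = -∫ x : ℝ, x ^ (n + 1) *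
      (-x * (Real.exp (-(1 / 2) * x ^ 2) / Real.sqrt (2 * Real.pi))) := by
    rw [gaussMoment, ← MeasureTheory.integral_neg]
    congr 1
    ext x
    ring
  rw [h1, h, neg_neg, gaussMoment, ← MeasureTheory.integral_const_mul]
  congr 1
  ext x
  push_cast
  ring

theorem gaussMoment_add_two_mul (n k : ℕ) :
    gaussMoment (2 * n + 2 * k)
      = (∏ j ∈ Finset.range k, (2 * (n : ℝ) + 2 * j + 1)) * gaussMoment (2 * n) := by
  induction k with
  | zero => simp
  | succ k ih =>
    rw [show 2 * n + 2 * (k + 1) = 2 * n + 2 * k + 2 by ring, gaussMoment_add_two, ih,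
      Finset.prod_range_succ]
    push_cast
    ring

/-- The perturbative expansion of the partition function. -/
def pertSeries (k : ℕ) : ℂ⟦X⟧ :=
  PowerSeries.mk fun n => (((-1) ^ n / n.factorial * gaussMoment (2 * k * n) : ℝ) : ℂ)

/-- This is (E_k) read on the coefficient of λ^n. -/
theorem coeff_pertSeries_succ (k n : ℕ) : ((n : ℂ) + 1) * coeff (n + 1) (pertSeries k)
    = -((∏ j ∈ Finset.range k, (2 * (k : ℂ) * n + (2 * j + 1))) * coeff n (pertSeries k)) := by
  rw [pertSeries, coeff_mk, coeff_mk]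
  have h := gaussMoment_add_two_mul (k * n) k
  rw [show 2 * (k * n) + 2 * k = 2 * k * (n + 1) by ring,
    show 2 * (k * n) = 2 * k * n by ring] at h
  rw [h, Nat.factorial_succ]
  have hn : ((n : ℂ) + 1) ≠ 0 := by exact_mod_cast n.succ_ne_zero
  have hf : ((n.factorial : ℕ) : ℂ) ≠ 0 := by exact_mod_cast n.factorial_ne_zero
  have hp : ((∏ j ∈ Finset.range k, (2 * ((k * n : ℕ) : ℝ) + 2 * j + 1) : ℝ) : ℂ)
      = ∏ j ∈ Finset.range k, (2 * (k : ℂ) * n + (2 * j + 1)) := by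
    push_cast
    exact Finset.prod_congr rfl fun j _ => by ring
  rw [← hp]
  push_cast
  field_simp
  ring

theorem exists_norm_exp_neg_sub_le (N : ℕ) : ∃ C : ℝ, ∀ z : ℂ, 0 ≤ z.re →
    ‖Complex.exp (-z) - ∑ n ∈ Finset.range (N + 1), (-z) ^ n / n.factorial‖
      ≤ C * ‖z‖ ^ (N + 1) := by
  -- The first summand is the Taylor bound for |z| ≤ 1. For |z| > 1 the exponential and the N + 1
  -- Taylor terms are each at most |z|^{N+1}, whence N + 2.
  refine ⟨(N + 1).succ * ((N + 1).factorial * (N + 1 : ℕ) : ℝ)⁻¹ + (N + 2), fun z hz => ?_⟩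
  have hpos : (0 : ℝ) ≤ (N + 1).succ * ((N + 1).factorial * (N + 1 : ℕ) : ℝ)⁻¹ := by positivity
  rcases le_or_gt ‖z‖ 1 with h | h
  · have := Complex.exp_bound (x := -z) (by rwa [norm_neg]) (Nat.succ_pos N)
    rw [norm_neg] at this
    refine this.trans ?_
    rw [mul_comm]
    gcongr
    have : (0 : ℝ) ≤ N := N.cast_nonneg
    linarith
  · have h1 : ‖Complex.exp (-z)‖ ≤ ‖z‖ ^ (N + 1) := by
      rw [Complex.norm_exp]
      refine (Real.exp_le_one_iff.2 ?_).trans (one_le_pow₀ h.le)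
      simpa using hz
    have h2 : ‖∑ n ∈ Finset.range (N + 1), (-z) ^ n / (n.factorial : ℂ)‖
        ≤ (N + 1) * ‖z‖ ^ (N + 1) := by
      refine (norm_sum_le_of_le (n := fun _ => ‖z‖ ^ (N + 1)) _ fun n hn => ?_).trans
        (by simp)
      rw [norm_div, norm_pow, norm_neg, Complex.norm_natCast]
      refine (div_le_self (by positivity) ?_).trans
        (pow_le_pow_right₀ h.le (Finset.mem_range.1 hn).le)
      exact_mod_cast Nat.one_le_iff_ne_zero.2 n.factorial_ne_zero
    refine (norm_sub_le _ _).trans ((add_le_add h1 h2).trans ?_)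
    have : 0 ≤ ‖z‖ ^ (N + 1) := by positivity
    nlinarith

theorem isAsymptoticExpansion_pertSeries (k : ℕ) :
    IsAsymptoticExpansion (partitionFunction k) (pertSeries k) := by
  intro N
  obtain ⟨C, hC⟩ := exists_norm_exp_neg_sub_le N
  set w : ℝ → ℝ := fun x => Real.exp (-(1 / 2) * x ^ 2) / Real.sqrt (2 * Real.pi) with hw
  have hw0 : ∀ x, 0 ≤ w x := fun x => by positivity
  have hwc : Continuous w := by fun_prop
  have hbound : ∀ l : ℂ, 0 < l.re →
      ‖partitionFunction k l - ∑ n ∈ Finset.range (N + 1), coeff n (pertSeries k) * l ^ n‖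
        ≤ C * gaussMoment (2 * k * (N + 1)) * ‖l‖ ^ (N + 1) := by
    intro l hl
    have hre : ∀ x : ℝ, 0 ≤ (l * (x : ℂ) ^ (2 * k)).re := fun x => by
      rw [← Complex.ofReal_pow, Complex.re_mul_ofReal]
      exact mul_nonneg hl.le (Even.pow_nonneg (even_two_mul k) x)
    have hZ : partitionFunction k l
        = ∫ x : ℝ, (w x : ℂ) * Complex.exp (-(l * (x : ℂ) ^ (2 * k))) := by
      rw [partitionFunction]
      congr 1
      ext x
      rw [sub_eq_add_neg, Complex.exp_add, hw]
      push_cast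
      ring
    have hint : MeasureTheory.Integrable fun x : ℝ =>
        (w x : ℂ) * Complex.exp (-(l * (x : ℂ) ^ (2 * k))) := by
      have h0 := integrable_pow_mul_gauss 0
      simp only [pow_zero, one_mul] at h0
      refine h0.mono' (Continuous.aestronglyMeasurable (by fun_prop)) (Filter.Eventually.of_forall
        fun x => ?_)
      rw [norm_mul, Complex.norm_real, Real.norm_of_nonneg (hw0 x)]
      refine mul_le_of_le_one_right (hw0 x) ?_
      rw [Complex.norm_exp, Real.exp_le_one_iff, Complex.neg_re]
      linarith [hre x]
    have hterm : ∀ n : ℕ, MeasureTheory.Integrable fun x : ℝ =>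
        (w x : ℂ) * ((-(l * (x : ℂ) ^ (2 * k))) ^ n / (n.factorial : ℂ)) := fun n => by
      have h1 : MeasureTheory.Integrable fun x : ℝ => ((x ^ (2 * k * n) * w x : ℝ) : ℂ) :=
        (integrable_pow_mul_gauss (2 * k * n)).ofReal
      refine (h1.const_mul ((-l) ^ n / (n.factorial : ℂ))).congr (Filter.Eventually.of_forall fun x => ?_)
      simp only [hw]
      push_cast
      rw [pow_mul, neg_mul_eq_neg_mul, mul_pow]
      ring
    have hcoeff : ∀ n : ℕ, coeff n (pertSeries k) * l ^ n = ∫ x : ℝ,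
        (w x : ℂ) * ((-(l * (x : ℂ) ^ (2 * k))) ^ n / (n.factorial : ℂ)) := fun n => by
      rw [pertSeries, coeff_mk, gaussMoment]
      push_cast
      rw [← integral_complex_ofReal, ← MeasureTheory.integral_const_mul,
        ← MeasureTheory.integral_mul_const]
      congr 1
      ext x
      simp only [hw]
      push_cast
      rw [pow_mul, neg_eq_neg_one_mul (l * _), mul_pow, mul_pow]
      ring
    rw [hZ, Finset.sum_congr rfl fun n _ => hcoeff n,
      ← MeasureTheory.integral_finsetSum _ fun n _ => hterm n,
      ← MeasureTheory.integral_sub hint (MeasureTheory.integrable_finsetSum _ fun n _ => hterm n)]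
    have hdom := (integrable_pow_mul_gauss (2 * k * (N + 1))).const_mul (C * ‖l‖ ^ (N + 1))
    refine (MeasureTheory.norm_integral_le_of_norm_le hdom (Filter.Eventually.of_forall
      fun x => ?_)).trans (le_of_eq ?_)
    · rw [← Finset.mul_sum, ← mul_sub, norm_mul, Complex.norm_real, Real.norm_of_nonneg (hw0 x)]
      have h2 := mul_le_mul_of_nonneg_left (hC _ (hre x)) (hw0 x)
      refine h2.trans (le_of_eq ?_)
      rw [norm_mul, norm_pow, Complex.norm_real, Real.norm_eq_abs,
        (even_two_mul k).pow_abs, mul_pow, ← pow_mul]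
      simp only [hw]
      ring
    · rw [MeasureTheory.integral_const_mul, gaussMoment]
      ring
  rw [tendsto_zero_iff_norm_tendsto_zero]
  have hlim : Filter.Tendsto (fun l : ℂ => C * gaussMoment (2 * k * (N + 1)) * ‖l‖)
      (nhdsWithin 0 {l : ℂ | 0 < l.re}) (nhds 0) := by
    have : Filter.Tendsto (fun l : ℂ => C * gaussMoment (2 * k * (N + 1)) * ‖l‖) (nhds 0)
        (nhds (C * gaussMoment (2 * k * (N + 1)) * ‖(0 : ℂ)‖)) :=
      Continuous.tendsto (by fun_prop) 0
    rw [norm_zero, mul_zero] at this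
    exact this.mono_left nhdsWithin_le_nhds
  refine squeeze_zero' (Filter.Eventually.of_forall fun l => norm_nonneg _) ?_ hlim
  filter_upwards [self_mem_nhdsWithin] with l hl
  have hl0 : 0 < ‖l‖ := norm_pos_iff.2 fun h => by
    rw [h] at hl
    exact lt_irrefl _ hl
  rw [norm_mul, norm_inv, norm_pow, inv_mul_le_iff₀ (by positivity)]
  refine (hbound l hl).trans (le_of_eq ?_)
  ring

/-! ### The perturbative series is a formal solution -/

/-- Without an exponential factor θ is diagonal on powers of x. -/
theorem eulerProd_expSeries_zero (A : ℂ) (n : ℕ) (a : ℂ → ℂ) :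
    eulerProd A n (expSeries 0 a) = expSeries 0 fun β =>
      (∏ j ∈ Finset.range n, (A * β + (2 * j + 1))) * a β := by
  induction n generalizing a with
  | zero => simp
  | succ n ih =>
    rw [eulerProd_succ, Module.End.mul_apply, LinearMap.add_apply, LinearMap.smul_apply,
      LinearMap.smul_apply, Module.End.one_apply, euler_expSeries, smul_expSeries, smul_expSeries,
      expSeries_add, ih]
    congr 1
    ext β
    rw [Finset.prod_range_succ]
    ring

theorem opEx_expMul_subst_pertSeries {K : ℕ} (hK : 1 ≤ K) :
    opEx (K + 1) (expMul 0 (PowerSeries.subst ((X : ℂ⟦X⟧) ^ K) (pertSeries (K + 1)))) = 0 := by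
  have hK0 : (K : ℂ) ≠ 0 := by exact_mod_cast (by omega : K ≠ 0)
  have hcoeff : ∀ n, coeff n (PowerSeries.subst ((X : ℂ⟦X⟧) ^ K) (pertSeries (K + 1)))
      = if K ∣ n then coeff (n / K) (pertSeries (K + 1)) else 0 := fun n => by
    rw [coeff_subst_X_pow (by omega)]
    rfl
  rw [expMul_eq]
  simp only [hcoeff]
  set a := Function.extend (Nat.cast : ℕ → ℂ)
    (fun n => if K ∣ n then coeff (n / K) (pertSeries (K + 1)) else 0) 0 with ha
  have han : ∀ n : ℕ, a ((K : ℂ) * n) = coeff n (pertSeries (K + 1)) := fun n => by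
    rw [← Nat.cast_mul, ha, Nat.cast_injective.extend_apply, if_pos (dvd_mul_right K n),
      Nat.mul_div_cancel_left _ (by omega)]
  have ha0 : ∀ z : ℂ, (¬ ∃ n : ℕ, (K : ℂ) * n = z) → a z = 0 := fun z hz => by
    by_cases h : ∃ n : ℕ, (n : ℂ) = z
    · obtain ⟨n, rfl⟩ := h
      rw [ha, Nat.cast_injective.extend_apply, if_neg]
      rintro ⟨m, rfl⟩
      exact hz ⟨m, by push_cast; ring⟩
    · exact Function.extend_apply' _ _ _ h
  rw [opEx_eq, LinearMap.add_apply, eulerProd_expSeries_zero, LinearMap.smul_apply,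
    Module.End.mul_apply, euler_expSeries, invX_pow_expSeries, smul_expSeries, expSeries_add,
    ← expSeries_zero 0]
  congr 1
  ext β
  rw [neg_zero, zero_mul, add_zero]
  by_cases h : ∃ n : ℕ, (K : ℂ) * n = β
  · obtain ⟨n, rfl⟩ := h
    have h1 : (K : ℂ) * n + K = K * ((n + 1 : ℕ) : ℂ) := by push_cast; ring
    have h2 := coeff_pertSeries_succ (K + 1) n
    have h3 : ∏ j ∈ Finset.range (K + 1), (2 * (K + 1) * (1 / K) * (K * n) + (2 * j + 1) : ℂ)
        = ∏ j ∈ Finset.range (K + 1), (2 * ((K + 1 : ℕ) : ℂ) * n + (2 * j + 1)) := by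
      refine Finset.prod_congr rfl fun j _ => ?_
      push_cast
      field_simp
    rw [h1, han, han, h3]
    push_cast at h2 ⊢
    field_simp
    linear_combination h2
  · rw [ha0 β h, mul_zero, zero_add]
    by_cases h' : ∃ n : ℕ, (K : ℂ) * n = β + K
    · obtain ⟨n, hn⟩ := h'
      rcases n with _ | n
      -- Here β = -K: the factor β + K vanishes, since ∂_λ kills constants.
      · rw [← hn]
        simp
      · refine absurd ⟨n, ?_⟩ h
        push_cast at hn
        linear_combination hn
    · rw [ha0 _ h']
      ring

/-! ### Gevrey orders under λ = x^K -/

theorem factorial_mul_le (K n : ℕ) :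
    (K * n).factorial ≤ (K ^ K) ^ n * n.factorial ^ K := by
  induction n with
  | zero => simp
  | succ n ih =>
    calc (K * (n + 1)).factorial = (K * n).factorial * (K * n + 1).ascFactorial K := by
          rw [Nat.factorial_mul_ascFactorial, Nat.mul_succ]
      _ ≤ ((K ^ K) ^ n * n.factorial ^ K) * (K * n + K) ^ K :=
          Nat.mul_le_mul ih (Nat.ascFactorial_le_pow_add _ _)
      _ = _ := by
          rw [← Nat.mul_succ, Nat.factorial_succ, mul_pow, mul_pow, Nat.succ_eq_add_one]
          ring

theorem IsGevrey.of_subst_X_pow {K : ℕ} (hK : 1 ≤ K) {Z Ψ : ℂ⟦X⟧} {c : ℂ} (hc : c ≠ 0)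
    (h : PowerSeries.subst ((X : ℂ⟦X⟧) ^ K) Z = c • Ψ) (hΨ : IsGevrey 1 Ψ) : IsGevrey K Z := by
  obtain ⟨C, hC, A, hA, hb⟩ := hΨ
  refine ⟨‖c‖ * C, mul_pos (norm_pos_iff.2 hc) hC, A ^ K * K ^ K, by positivity, fun n => ?_⟩
  have h1 : coeff n Z = c * coeff (K * n) Ψ := by
    have h2 := congrArg (coeff (K * n)) h
    rw [coeff_subst_X_pow (by omega), if_pos (dvd_mul_right K n),
      Nat.mul_div_cancel_left _ (by omega)] at h2
    simpa using h2
  have h3 := hb (K * n)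
  rw [Real.rpow_one] at h3
  have h4 : ((K * n).factorial : ℝ) ≤ (K ^ K) ^ n * n.factorial ^ K := by
    exact_mod_cast factorial_mul_le K n
  rw [h1, norm_mul, Real.rpow_natCast]
  calc ‖c‖ * ‖coeff (K * n) Ψ‖ ≤ ‖c‖ * (C * A ^ (K * n) * ((K ^ K) ^ n * n.factorial ^ K)) := by
        gcongr
        exact h3.trans (by gcongr)
    _ = _ := by rw [mul_pow, pow_mul]; ring

/-! ### The roots of the characteristic polynomial -/

theorem charPoly_eq_zero_iff {K : ℕ} (hK : 1 ≤ K) (z : ℂ) : charPoly (K + 1) z = 0 ↔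
    z = 0 ∨ z ^ K = -((-1) ^ K * (2 * (K + 1)) ^ (K + 1) * (1 / K) ^ K : ℂ)⁻¹ := by
  have hK0 : (K : ℂ) ≠ 0 := by exact_mod_cast (by omega : K ≠ 0)
  have hK1 : (K : ℂ) + 1 ≠ 0 := by exact_mod_cast K.succ_ne_zero
  have h : charPoly (K + 1) z = -(1 / K) *
      (z * (((-1) ^ K * (2 * (K + 1)) ^ (K + 1) * (1 / K) ^ K) * z ^ K + 1)) := by
    simp only [charPoly, Nat.add_sub_cancel]
    push_cast
    rw [add_sub_cancel_right, mul_pow (1 / (K : ℂ)) z]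
    ring
  have hD : ((-1) ^ K * (2 * (K + 1)) ^ (K + 1) * (1 / K) ^ K : ℂ) ≠ 0 := by
    simp [hK0, hK1]
  rw [h]
  generalize ((-1) ^ K * (2 * (K + 1)) ^ (K + 1) * (1 / K) ^ K : ℂ) = D at hD ⊢
  rw [mul_eq_zero, or_iff_right (neg_ne_zero.2 (one_div_ne_zero hK0)), mul_eq_zero,
    add_eq_zero_iff_eq_neg]
  refine or_congr_right ⟨fun h => mul_left_cancel₀ hD ?_, fun h => ?_⟩
  · rw [h, mul_neg, mul_inv_cancel₀ hD]
  · rw [h, mul_neg, mul_inv_cancel₀ hD]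

theorem exists_roots_charPoly {K : ℕ} (hK : 1 ≤ K) : ∃ u : Fin (K + 1) → ℂ, u 0 = 0 ∧
    Function.Injective u ∧ ∀ z, charPoly (K + 1) z = 0 ↔ ∃ i, u i = z := by
  have hK0 : (K : ℂ) ≠ 0 := by exact_mod_cast (by omega : K ≠ 0)
  have hK1 : (K : ℂ) + 1 ≠ 0 := by exact_mod_cast K.succ_ne_zero
  have hD : -((-1) ^ K * (2 * (K + 1)) ^ (K + 1) * (1 / K) ^ K : ℂ)⁻¹ ≠ 0 := by
    simp [hK0, hK1]
  have hchar := charPoly_eq_zero_iff hK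
  generalize -((-1) ^ K * (2 * (K + 1)) ^ (K + 1) * (1 / K) ^ K : ℂ)⁻¹ = D at hD hchar
  obtain ⟨α, hα⟩ := IsAlgClosed.exists_pow_nat_eq D (show 0 < K by omega)
  have hα0 : α ≠ 0 := by
    rintro rfl
    rw [zero_pow (by omega)] at hα
    exact hD hα.symm
  have : NeZero K := ⟨by omega⟩
  have hζ := Complex.isPrimitiveRoot_exp K (by omega)
  set ζ := Complex.exp (2 * Real.pi * Complex.I / K)
  have hζ0 : ζ ≠ 0 := Complex.exp_ne_zero _
  -- The nonzero roots solve z^K = D: one solution α times the K-th roots of unity.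
  refine ⟨Fin.cons 0 fun i : Fin K => α * ζ ^ (i : ℕ), rfl, ?_, fun z => ?_⟩
  · rw [Fin.cons_injective_iff]
    refine ⟨?_, fun i j hij => ?_⟩
    · rintro ⟨i, hi⟩
      exact mul_ne_zero hα0 (pow_ne_zero _ hζ0) hi
    · exact Fin.ext (hζ.pow_inj i.2 j.2 (mul_left_cancel₀ hα0 hij))
  · rw [hchar, Fin.exists_fin_succ]
    simp only [Fin.cons_zero, Fin.cons_succ]
    refine or_congr eq_comm ⟨fun h => ?_, ?_⟩
    · have h1 : (z / α) ^ K = 1 := by rw [div_pow, h, hα, div_self hD]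
      obtain ⟨i, hi, h2⟩ := hζ.eq_pow_of_pow_eq_one h1
      exact ⟨⟨i, hi⟩, by rw [h2, mul_div_cancel₀ _ hα0]⟩
    · rintro ⟨i, rfl⟩
      rw [mul_pow, hα, ← pow_mul, mul_comm (i : ℕ), pow_mul, hζ.pow_eq_one, one_pow, mul_one]

/-! ### The basis of formal solutions -/

theorem linearIndependent_expMul {ι : Type*} {u : ι → ℂ} (hu : Function.Injective u)
    {Φ : ι → ℂ⟦X⟧} (hΦ : ∀ i, coeff 0 (Φ i) = 1) :
    LinearIndependent ℂ fun i => expMul (u i) (Φ i) := by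
  rw [linearIndependent_iff']
  intro s g hg i hi
  have h := congrFun hg (Finsupp.single ⟨1, one_pos⟩ (u i), 0, ((0 : ℕ) : ℂ))
  rw [Finset.sum_apply, Finset.sum_eq_single i] at h
  · rw [Pi.smul_apply, expMul_apply, hΦ] at h
    simpa using h
  · intro j _ hj
    rw [Pi.smul_apply, expMul_apply_of_ne (hu.ne hj), smul_zero]
  · exact fun h => absurd hi h

/-- The scalar σ_i is read off at e^{u_i/x} x^0, where Φ_i has coefficient 1; the difference then
vanishes by uniqueness. -/
theorem opEx_eq_zero_iff {K : ℕ} (hK : 1 ≤ K) {ι : Type*} [Fintype ι] {u : ι → ℂ}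
    (hu : Function.Injective u) (hroot : ∀ z, charPoly (K + 1) z = 0 ↔ ∃ i, u i = z)
    {Φ : ι → ℂ⟦X⟧} (hΦ : ∀ i, coeff 0 (Φ i) = 1)
    (hsol : ∀ i, opEx (K + 1) (expMul (u i) (Φ i)) = 0) {f : FormalArray}
    (hf : f ∈ formalFunctions) :
    opEx (K + 1) f = 0 ↔ ∃ σ : ι → ℂ, f = ∑ i, σ i • expMul (u i) (Φ i) := by
  constructor
  · intro hT
    refine ⟨fun i => f (Finsupp.single ⟨1, one_pos⟩ (u i), 0, 0), ?_⟩
    rw [← sub_eq_zero]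
    refine eq_zero_of_opEx_eq_zero (K := K) (hasLowerFiniteSupport_of_mem (Submodule.sub_mem _ hf
      (Submodule.sum_mem _ fun i _ => Submodule.smul_mem _ _ (expMul_mem _ _)))) hK ?_ ?_
    · rw [map_sub, hT, map_sum, Finset.sum_eq_zero, sub_zero]
      intro i _
      rw [map_smul, hsol, smul_zero]
    · intro v hv
      obtain ⟨i, rfl⟩ := (hroot v).1 hv
      rw [Pi.sub_apply, Finset.sum_apply, Finset.sum_eq_single i]
      · have := expMul_apply (u i) (Φ i) 0
        rw [hΦ, Nat.cast_zero] at this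
        rw [Pi.smul_apply, this]
        simp
      · intro j _ hj
        rw [Pi.smul_apply, expMul_apply_of_ne (hu.ne hj), smul_zero]
      · simp
  · rintro ⟨σ, rfl⟩
    rw [map_sum]
    refine Finset.sum_eq_zero fun i _ => ?_
    rw [map_smul, hsol, smul_zero]

end PartitionResurgence

end

theorem mainTheorem2 (k : ℕ) (hk : 2 ≤ k) :
    ∃ (u : Fin k → ℂ) (Φ : Fin k → PowerSeries ℂ),
      -- `u_0 = 0, u_1, …, u_{k-1}` are the `k` (distinct) roots of `P`
      u ⟨0, by omega⟩ = 0 ∧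
      Function.Injective u ∧
      (∀ z : ℂ, PartitionResurgence.charPoly k z = 0 ↔ ∃ i, u i = z) ∧
      -- the `e^{u_i/x} Φ_i(x)` form a basis of the space of formal solutions of `(E_k)`
      LinearIndependent ℂ (fun i => PartitionResurgence.expMul (u i) (Φ i)) ∧
      (∀ f ∈ PartitionResurgence.formalFunctions,
        PartitionResurgence.opEx k f = 0 ↔
          ∃ σ : Fin k → ℂ, f = ∑ i, σ i • PartitionResurgence.expMul (u i) (Φ i)) ∧
      (∀ i, PartitionResurgence.IsGevrey 1 (Φ i)) ∧
      -- the perturbative series `Z(λ)`, with `λ = x^{k-1}`, is proportional to `Φ_0(x)`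
      ∃ Z : PowerSeries ℂ,
        PartitionResurgence.IsAsymptoticExpansion (PartitionResurgence.partitionFunction k) Z ∧
        (∃ c : ℂ, c ≠ 0 ∧
          PowerSeries.subst ((PowerSeries.X : PowerSeries ℂ) ^ (k - 1)) Z
            = c • Φ ⟨0, by omega⟩) ∧
        PartitionResurgence.IsGevrey ((k : ℝ) - 1) Z := by
  open PartitionResurgence in
  obtain ⟨K, rfl⟩ : ∃ K, k = K + 1 := ⟨k - 1, by omega⟩
  have hK : 1 ≤ K := by omega
  obtain ⟨u, hu0, hu, hroot⟩ := exists_roots_charPoly hK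
  have hP : ∀ i, charPoly (K + 1) (u i) = 0 := fun i => (hroot _).2 ⟨i, rfl⟩
  set Φ : Fin (K + 1) → ℂ⟦X⟧ := fun i => PowerSeries.mk (solCoeff K (-(u i))) with hΦdef
  have hΦ : ∀ i, coeff 0 (Φ i) = 1 := fun i => by rw [hΦdef, coeff_mk, solCoeff_zero]
  have hsol : ∀ i, opEx (K + 1) (expMul (u i) (Φ i)) = 0 := fun i =>
    opEx_expMul_solCoeff hK (hP i)
  have hG : ∀ i, IsGevrey 1 (Φ i) := fun i =>
    isGevrey_solCoeff (subleading_ne_zero hK (by rw [neg_neg]; exact hP i))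
  have hbasis := fun f (hf : f ∈ formalFunctions) => opEx_eq_zero_iff hK hu hroot hΦ hsol hf
  obtain ⟨σ, hσ⟩ := (hbasis _ (expMul_mem 0 _)).1 (opEx_expMul_subst_pertSeries hK)
  -- Comparison of the components without exponential factor: the other u_j are nonzero.
  have hsub : PowerSeries.subst ((X : ℂ⟦X⟧) ^ K) (pertSeries (K + 1)) = σ 0 • Φ 0 := by
    ext n
    have h := congrFun hσ (Finsupp.single ⟨1, one_pos⟩ 0, 0, (n : ℂ))
    rw [expMul_apply, Finset.sum_apply, Finset.sum_eq_single 0] at h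
    · rw [h, Pi.smul_apply, hu0, expMul_apply, coeff_smul]
    · intro j _ hj
      rw [Pi.smul_apply, expMul_apply_of_ne (by rw [← hu0]; exact hu.ne hj), smul_zero]
    · simp
  -- The constant term of the perturbative series is the total Gaussian mass, 1.
  have hc : σ 0 ≠ 0 := by
    intro h0
    have h := congrArg (coeff 0) hsub
    rw [h0, zero_smul, map_zero, coeff_subst_X_pow (by omega), if_pos (dvd_zero K), Nat.zero_div,
      pertSeries, coeff_mk] at h
    simp [gaussMoment_zero] at h
  refine ⟨u, Φ, hu0, hu, hroot, linearIndependent_expMul hu hΦ, hbasis, hG, pertSeries (K + 1),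
    isAsymptoticExpansion_pertSeries _, ⟨σ 0, hc, hsub⟩, ?_⟩
  have := IsGevrey.of_subst_X_pow hK hc hsub (hG 0)
  rwa [Nat.cast_add, Nat.cast_one, add_sub_cancel_right]
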